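/- Let $S^2$ be the unit sphere in $\mathbb R^3$ with surface measure $\sigma$. For a nonnegative $f\in L^2(S^2,\sigma)$ let $f_\star$ be its antipodally symmetric rearrangement, the unique nonnegative element of $L^2(S^2,\sigma)$ with $f_\star(-x)=f_\star(x)$ and $f_\star(x)^2+f_\star(-x)^2=f(x)^2+f(-x)^2$ for all $x\in S^2$. Let $*$ denote convolution of measures on $\mathbb R^3$; the $L^2(\mathbb R^3)$ norm of a measure is that of its density with respect to Lebesgue measure. For complex-valued $f\in L^2(S^2,\sigma)$ let $\widehat{f\sigma}(\xi)=\int_{S^2}e^{-ix\cdot\xi}f(x)\,d\sigma(x)$, let $$\mathcal R=\sup_{0\ne f\in L^2(S^2,\sigma)}\frac{\|\widehat{f\sigma}\|_{L^4(\mathbb R^3)}}{\|f\|_{L^2(S^2,\sigma)}},$$ and call $f\in L^2(S^2,\sigma)$ an extremizer if $f\neq 0$ and $\|\widehat{f\sigma}\|_{L^4(\mathbb R^3)}=\mathcal R\,\|f\|_{L^2(S^2,\sigma)}$. Proposition. For every nonnegative $f\in L^2(S^2,\sigma)$, $$\|f\sigma*f\sigma\|_{L^2(\mathbb R^3)}\le\|f_\star\sigma*f_\star\sigma\|_{L^2(\mathbb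 R^3)},$$ with strict inequality unless $f=f_\star$ almost everywhere. Moreover, every complex-valued extremizer $f$ satisfies $|f(-x)|=|f(x)|$ for $\sigma$-almost every $x\in S^2$. -/

import Mathlib

open MeasureTheory
open scoped ENNReal

noncomputable section

namespace SphereRestriction

/-- Euclidean three-space. -/
abbrev R3 : Type := EuclideanSpace ℝ (Fin 3)

/-- The unit sphere in three-space. -/
abbrev S2 : Type := Metric.sphere (0 : R3) 1

/-- Surface measure on the unit sphere (not normalized: the total mass is `4 * π`). -/
def surfaceMeasure : Measure S2 := (volume : Measure R3).toSphere

/-- For a nonnegative function `f` on the sphere, the measure on three-space that has density `f`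
with respect to surface measure. -/
def densityMeasure (f : S2 → ℝ) : Measure R3 :=
  (surfaceMeasure.withDensity (fun x => ENNReal.ofReal (f x))).map (fun x : S2 => (x : R3))

open Classical in
/-- The `L²` norm of a (positive, finite) measure on three-space: the `L²` norm of its Lebesgue
density if it is absolutely continuous, and `∞` otherwise. -/
def measureL2Norm (μ : Measure R3) : ℝ≥0∞ :=
  if μ ≪ volume then eLpNorm (μ.rnDeriv volume) 2 volume else ∞

/-- The `L²` norm over three-space of the convolution of the measure `f σ` with itself. -/
def selfConvL2Norm (f : S2 → ℝ) : ℝ≥0∞ :=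
  measureL2Norm ((densityMeasure f).conv (densityMeasure f))

/-- `g` is an antipodally symmetric rearrangement of `f`: a nonnegative, antipodally symmetric
function with `g(x)² + g(-x)² = f(x)² + f(-x)²`. -/
structure IsAntipodalRearrangement (f g : S2 → ℝ) : Prop where
  nonneg : ∀ x, 0 ≤ g x
  symm : ∀ x, g (-x) = g x
  sq_add_sq : ∀ x, g x ^ 2 + g (-x) ^ 2 = f x ^ 2 + f (-x) ^ 2

/-- The antipodally symmetric rearrangement of `f`. -/
def antipodalRearrangement (f : S2 → ℝ) (x : S2) : ℝ :=
  Real.sqrt ((f x ^ 2 + f (-x) ^ 2) / 2)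

/-- `antipodalRearrangement f` is the unique antipodally symmetric rearrangement of `f`. -/
theorem isAntipodalRearrangement_iff (f g : S2 → ℝ) :
    IsAntipodalRearrangement f g ↔ g = antipodalRearrangement f := by
  constructor
  · intro h
    funext x
    have h1 := h.sq_add_sq x
    rw [h.symm x] at h1
    rw [antipodalRearrangement, ← h1, ← Real.sqrt_sq (h.nonneg x)]
    congr 1
    rw [Real.sqrt_sq (h.nonneg x)]
    ring
  · rintro rfl
    have hs : ∀ x, antipodalRearrangement f (-x) = antipodalRearrangement f x := by
      intro x
      simp only [antipodalRearrangement, neg_neg, add_comm]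
    refine ⟨fun x => Real.sqrt_nonneg _, hs, fun x => ?_⟩
    rw [hs x, antipodalRearrangement, Real.sq_sqrt (by positivity)]
    ring

/-- Surface measure is invariant under the antipodal map. -/
theorem measurePreserving_neg_surfaceMeasure :
    MeasurePreserving (fun x : S2 => -x) surfaceMeasure surfaceMeasure := by
  have hm : Measurable (fun x : S2 => -x) := continuous_neg.measurable
  refine ⟨hm, ?_⟩
  ext s hs
  rw [Measure.map_apply hm hs, surfaceMeasure, Measure.toSphere_apply' _ (hm hs),
    Measure.toSphere_apply' _ hs]
  have h1 : ((fun x : S2 => (x : R3)) '' ((fun x : S2 => -x) ⁻¹' s))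
      = -((fun x : S2 => (x : R3)) '' s) := by
    ext y
    simp only [Set.mem_image, Set.mem_preimage, Set.mem_neg]
    constructor
    · rintro ⟨x, hx, rfl⟩
      exact ⟨-x, hx, rfl⟩
    · rintro ⟨x, hx, hxy⟩
      exact ⟨-x, by simpa using hx, by simp [hxy]⟩
  rw [h1, Set.smul_neg, Measure.measure_neg]

/-- The antipodally symmetric rearrangement of an `L²` function is in `L²`. -/
theorem memLp_antipodalRearrangement {f : S2 → ℝ} (hf : MemLp f 2 surfaceMeasure) :
    MemLp (antipodalRearrangement f) 2 surfaceMeasure := by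
  have hn : MemLp (fun x => f (-x)) 2 surfaceMeasure :=
    hf.comp_measurePreserving measurePreserving_neg_surfaceMeasure
  have hmeas : AEStronglyMeasurable (antipodalRearrangement f) surfaceMeasure := by
    have h1 := hf.aestronglyMeasurable
    have h2 := hn.aestronglyMeasurable
    have hc : Continuous (fun t : ℝ => Real.sqrt (t / 2)) := by fun_prop
    exact hc.comp_aestronglyMeasurable ((h1.pow 2).add (h2.pow 2))
  rw [memLp_two_iff_integrable_sq hmeas]
  refine ((hf.integrable_sq.add hn.integrable_sq).div_const 2).congr (ae_of_all _ fun x => ?_)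
  simp only [antipodalRearrangement, Pi.add_apply]
  rw [Real.sq_sqrt (by positivity)]

/-- The Fourier transform of the complex measure `f σ`, at frequency `ξ`:
`∫ exp(-i x·ξ) f(x) dσ(x)`. -/
def fourierExtension (f : S2 → ℂ) (ξ : R3) : ℂ :=
  ∫ x : S2, Complex.exp (-(Complex.I * ((inner ℝ (x : R3) ξ : ℝ) : ℂ))) * f x ∂surfaceMeasure

/-- The optimal constant in the `L²(S²) → L⁴(ℝ³)` adjoint Fourier restriction inequality. -/
def optimalConstant : ℝ≥0∞ :=
  ⨆ (f : S2 → ℂ) (_ : MemLp f 2 surfaceMeasure) (_ : ¬ f =ᵐ[surfaceMeasure] 0),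
    eLpNorm (fourierExtension f) 4 volume / eLpNorm f 2 surfaceMeasure

/-- A nonzero function in `L²(S²)` that attains the optimal constant. -/
structure IsExtremizer (f : S2 → ℂ) : Prop where
  memLp : MemLp f 2 surfaceMeasure
  ne_zero : ¬ f =ᵐ[surfaceMeasure] 0
  attains : eLpNorm (fourierExtension f) 4 volume
    = optimalConstant * eLpNorm f 2 surfaceMeasure

end SphereRestriction

end

/-!
Write `f̃ x = f (-x)` and let `f⋆` be the antipodal rearrangement of `f ≥ 0`. By Plancherel's
theorem, `‖fσ * fσ‖₂` is a constant times the square of the `L⁴` norm of the Fourier transform of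
`fσ`. For real `f` the transforms of `fσ` and `f̃σ` are conjugate, so `fσ * f̃σ` has the same norm as
`fσ * fσ`. After symmetrization `fσ * f̃σ` is the image under `(a, b) ↦ a + b` of the density
`(f a f̃ b + f̃ a f b) / 2`, which is at most `f⋆ a f⋆ b` by the Cauchy-Schwarz inequality
(`symmetrized_mul_le`). The `L²` norm is monotone on positive measures, which gives the inequality.

Comparisons of `L²` norms are made on the Fourier side with the weight `exp (-ε ‖ξ‖²)`: the
regularized energy is then a quadratic form with a positive Gaussian kernel
(`gaussianEnergy_phaseIntegral`), hence monotone and superadditive on nonnegative densities, and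
`ε → 0` by monotone convergence. Superadditivity shows that the gain in energy is at least the energy
of the defect `f⋆ a f⋆ b - (f a f̃ b + f̃ a f b) / 2` (`extensionEnergy_add_defect_le`). If there is no
gain, the defect has zero transform and zero mass, so `∫ f = ∫ f⋆`, and `f + f̃ ≤ 2 f⋆` forces `f = f⋆`.

Strictness needs the energies to be finite, which is the adjoint Fourier restriction inequality
`L²(S²) → L⁴(ℝ³)`. It suffices to treat symmetric `f`, for which the regularized energy is a
quadrilinear form with kernel concentrated on `a + b + c + d = 0`. Since
`‖a + b‖² + ‖a + c‖² + ‖b + c‖² = 3 + ‖a + b + c‖²`, some pairing of the four points has no nearly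
antipodal pair (`exists_pairing_of_norm_add_le`), and away from the origin the density `2π / ‖x‖` of
`σ * σ` is bounded (`lintegral_lintegral_gaussianKernel_le`, from Archimedes' hat-box theorem).

For an extremizer `f`, monotonicity bounds the energy of `f` by that of `|f|`. Were `|f|` not symmetric,
`|f|⋆` would have the same `L²` norm as `f` and strictly larger energy.
-/

namespace SphereRestriction

/-! ### Plancherel's theorem for finite measures -/

section Plancherel

open scoped FourierTransform SchwartzMap ContDiff

variable {V : Type*} [NormedAddCommGroup V] [InnerProductSpace ℝ V] [FiniteDimensional ℝ V]

theorem exists_contDiff_bump {K U : Set V} (hK : IsCompact K) (hU : IsOpen U) (hKU : K ⊆ U) :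
    ∃ φ : V → ℝ, ContDiff ℝ ∞ φ ∧ HasCompactSupport φ ∧ (∀ x, φ x ∈ Set.Icc (0 : ℝ) 1) ∧
      (∀ x ∈ K, φ x = 1) ∧ (∀ x ∉ U, φ x = 0) := by
  obtain ⟨L, hL, hKL, hLU⟩ := exists_compact_between hK hU hKU
  obtain ⟨f, hf0, hf1, hf⟩ := exists_contMDiffMap_zero_one_of_isClosed (modelWithCornersSelf ℝ V)
    (n := ⊤) (s := (interior L)ᶜ) (t := K) isOpen_interior.isClosed_compl hK.isClosed
    (Set.disjoint_left.2 fun x hx hxK => hx (hKL hxK))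
  refine ⟨f, f.contMDiff.contDiff, ?_, hf, fun x hx => hf1 hx, fun x hx => hf0 ?_⟩
  · refine HasCompactSupport.intro hL fun x hx => hf0 ?_
    exact fun h => hx (interior_subset h)
  · exact fun h => hx (hLU (interior_subset h))

variable [MeasurableSpace V] [BorelSpace V]

/-- The Fourier transform is self-adjoint, tested on a finite measure: the frequency function
`ξ ↦ charFun ν (-2πξ)` is the Fourier transform of `ν` in the normalization of Mathlib's `𝓕`. -/
theorem integral_schwartz_fourierInv_mul_charFun (ν : Measure V) [IsFiniteMeasure ν]
    (φ : 𝓢(V, ℂ)) :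
    ∫ ξ, (𝓕⁻ φ) ξ * charFun ν (-(2 * Real.pi) • ξ) = ∫ x, φ x ∂ν := by
  have h := VectorFourier.integral_fourierIntegral_smul_eq_flip (μ := ν) (ν := volume)
    (L := innerₗ V) (f := (1 : V → ℂ)) (g := (𝓕⁻ φ : 𝓢(V, ℂ)))
    Real.continuous_fourierChar (by exact continuous_inner) (integrable_const _)
    (𝓕⁻ φ).integrable
  have h2 : (VectorFourier.fourierIntegral Real.fourierChar volume (innerₗ V).flip
      (𝓕⁻ φ : 𝓢(V, ℂ))) = φ := by
    rw [flip_innerₗ]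
    change 𝓕 ((𝓕⁻ φ : 𝓢(V, ℂ)) : V → ℂ) = φ
    rw [← SchwartzMap.fourier_coe, FourierTransform.fourier_fourierInv_eq]
  rw [h2] at h
  simp only [Pi.one_apply, one_smul] at h
  rw [← h]
  congr 1
  funext ξ
  rw [charFun_eq_fourierIntegral', smul_smul, smul_eq_mul, mul_comm]
  have : -(2 * Real.pi)⁻¹ * -(2 * Real.pi) = 1 := by
    field_simp
  rw [this, one_smul]

theorem memLp_two_comp_smul {F : Type*} [NormedAddCommGroup F] {f : V → F} {c : ℝ} (hc : c ≠ 0) :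
    MemLp f 2 volume → MemLp (fun x => f (c • x)) 2 (volume : Measure V) := by
  intro h
  have hmap := Measure.map_addHaar_smul (volume : Measure V) hc
  have h2 : MemLp f 2 (Measure.map (fun x => c • x) (volume : Measure V)) := by
    rw [hmap]
    exact h.smul_measure ENNReal.ofReal_ne_top
  exact h2.comp_of_map (measurable_const_smul c).aemeasurable

/-- If the characteristic function of `ν` is square integrable, its inverse `L²` Fourier transform
`g` represents `ν` on Schwartz functions. That `g` is a density of `ν` is shown below. -/
theorem exists_lp_two_integral_schwartz_eq (ν : Measure V) [IsFiniteMeasure ν]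
    (h : MemLp (charFun ν) 2 volume) :
    ∃ g : Lp ℂ 2 (volume : Measure V), (∀ φ : 𝓢(V, ℂ), ∫ x, φ x ∂ν = ∫ x, φ x * g x) ∧
      ‖g‖ₑ = eLpNorm (fun ξ => charFun ν (-(2 * Real.pi) • ξ)) 2 volume := by
  have hF : MemLp (fun ξ => charFun ν (-(2 * Real.pi) • ξ)) 2 volume :=
    memLp_two_comp_smul (by simp [Real.pi_ne_zero]) h
  set F : Lp ℂ 2 (volume : Measure V) := hF.toLp with hFdef
  refine ⟨𝓕⁻ F, fun φ => ?_, ?_⟩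
  · have h1 : ((𝓕⁻ F : Lp ℂ 2 (volume : Measure V)) : 𝓢'(V, ℂ)) φ =
        (F : 𝓢'(V, ℂ)) (𝓕⁻ φ) := by
      rw [← Lp.fourierInv_toTemperedDistribution_eq, TemperedDistribution.fourierInv_apply]
    rw [Lp.toTemperedDistribution_apply, Lp.toTemperedDistribution_apply] at h1
    simp only [smul_eq_mul] at h1
    rw [h1, ← integral_schwartz_fourierInv_mul_charFun]
    refine integral_congr_ae ?_
    filter_upwards [hF.coeFn_toLp] with x hx
    rw [hFdef, hx]
  · have h1 : ‖(𝓕⁻ F : Lp ℂ 2 (volume : Measure V))‖ = ‖F‖ :=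
      (Lp.fourierTransformₗᵢ V ℂ).symm.norm_map F
    rw [← ofReal_norm, h1, ofReal_norm, hFdef, Lp.enorm_toLp]

/-- A finite measure represented by an `L²` function on Schwartz functions satisfies
`ν U ≤ |U| ^ (1 / 2) * ‖g‖₂` for open `U`, by the Cauchy-Schwarz inequality applied to smooth
functions approximating the indicator of `U`; so it charges no null set. -/
theorem absolutelyContinuous_of_schwartz_integral_eq {ν : Measure V} [IsFiniteMeasure ν]
    {g : Lp ℂ 2 (volume : Measure V)}
    (hg : ∀ φ : 𝓢(V, ℂ), ∫ x, φ x ∂ν = ∫ x, φ x * g x) : ν ≪ volume := by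
  have hgm : MemLp g 2 volume := Lp.memLp g
  have key : ∀ U : Set V, IsOpen U → ν U ≤ volume U ^ (1 / 2 : ℝ) * eLpNorm g 2 volume := by
    intro U hU
    rw [hU.measure_eq_iSup_isCompact ν]
    refine iSup₂_le fun K hKU => iSup_le fun hK => ?_
    obtain ⟨φ, hφ, hφc, hφI, hφ1, hφ0⟩ := exists_contDiff_bump hK hU hKU
    have hψc : HasCompactSupport (fun x => (φ x : ℂ)) := hφc.comp_left (g := Complex.ofReal) rfl
    have hψ : ContDiff ℝ ∞ (fun x => (φ x : ℂ)) := Complex.ofRealCLM.contDiff.comp hφ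
    have h1 := hg (hψc.toSchwartzMap hψ)
    simp only [HasCompactSupport.toSchwartzMap_toFun] at h1
    have hint : Integrable φ ν := hφ.continuous.integrable_of_hasCompactSupport hφc
    calc ν K ≤ ∫⁻ x, ‖(φ x : ℂ)‖ₑ ∂ν := by
          rw [← lintegral_indicator_one hK.measurableSet]
          refine lintegral_mono fun x => ?_
          by_cases hx : x ∈ K
          · simp [hx, hφ1 x hx]
          · simp [hx]
      _ = ‖∫ x, (φ x : ℂ) ∂ν‖ₑ := by
          rw [integral_complex_ofReal, ← ofReal_norm, Complex.norm_real, Real.norm_eq_abs,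
            abs_of_nonneg (integral_nonneg fun x => (hφI x).1),
            ofReal_integral_eq_lintegral_ofReal hint (ae_of_all _ fun x => (hφI x).1)]
          refine lintegral_congr fun x => ?_
          rw [← ofReal_norm, Complex.norm_real, Real.norm_eq_abs, abs_of_nonneg (hφI x).1]
      _ = ‖∫ x, (φ x : ℂ) * g x‖ₑ := by rw [h1]
      _ ≤ ∫⁻ x, ‖(φ x : ℂ) * g x‖ₑ := enorm_integral_le_lintegral_enorm _
      _ ≤ ∫⁻ x, U.indicator (fun _ => (1 : ℝ≥0∞)) x * ‖g x‖ₑ := by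
          refine lintegral_mono fun x => ?_
          rw [enorm_mul]
          gcongr
          by_cases hx : x ∈ U
          · rw [← ofReal_norm, Complex.norm_real, Real.norm_eq_abs, abs_of_nonneg (hφI x).1]
            simpa [hx] using (hφI x).2
          · simp [hx, hφ0 x hx]
      _ ≤ (∫⁻ x, U.indicator (fun _ => (1 : ℝ≥0∞)) x ^ (2 : ℝ)) ^ (1 / 2 : ℝ) *
            (∫⁻ x, ‖g x‖ₑ ^ (2 : ℝ)) ^ (1 / 2 : ℝ) :=
          ENNReal.lintegral_mul_le_Lp_mul_Lq _ (by norm_num [Real.holderConjugate_iff])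
            ((measurable_const.indicator hU.measurableSet).aemeasurable)
            hgm.aestronglyMeasurable.enorm
      _ = _ := by
          congr 1
          · congr 1
            rw [← lintegral_indicator_one hU.measurableSet]
            refine lintegral_congr fun x => ?_
            by_cases hx : x ∈ U <;> simp [hx]
          · rw [eLpNorm_eq_lintegral_rpow_enorm_toReal (by norm_num) (by norm_num)]
            simp
  intro s hs
  by_contra hne
  have hgt : eLpNorm g 2 volume ≠ ⊤ := hgm.eLpNorm_ne_top
  have hle : ∀ n : ℕ, ν s ≤ ((n : ℝ≥0∞) + 1)⁻¹ ^ (1 / 2 : ℝ) * eLpNorm g 2 volume := by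
    intro n
    obtain ⟨U, hsU, hU, hUv⟩ := s.exists_isOpen_lt_of_lt (μ := volume) ((n : ℝ≥0∞) + 1)⁻¹
      (by rw [hs]; simp)
    calc ν s ≤ ν U := measure_mono hsU
      _ ≤ _ := key U hU
      _ ≤ _ := by gcongr
  have hlim : Filter.Tendsto
      (fun n : ℕ => ((n : ℝ≥0∞) + 1)⁻¹ ^ (1 / 2 : ℝ) * eLpNorm g 2 volume)
      Filter.atTop (nhds 0) := by
    have h1 : Filter.Tendsto (fun n : ℕ => ((n : ℝ≥0∞) + 1)⁻¹) Filter.atTop (nhds 0) := by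
      have := (ENNReal.tendsto_inv_nat_nhds_zero).comp (Filter.tendsto_add_atTop_nat 1)
      refine this.congr fun n => by simp
    have h2 := h1.ennrpow_const (1 / 2 : ℝ)
    rw [ENNReal.zero_rpow_of_pos (by norm_num)] at h2
    have h3 := ENNReal.Tendsto.mul_const h2 (Or.inr hgt)
    simpa using h3
  exact hne (le_antisymm (ge_of_tendsto' hlim hle) zero_le)

/-- Plancherel's theorem for a finite measure: if the characteristic function is square integrable
then the measure has a square integrable density, of the same norm. -/
theorem eLpNorm_rnDeriv_eq_of_memLp_charFun (ν : Measure V) [IsFiniteMeasure ν]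
    (h : MemLp (charFun ν) 2 volume) :
    ν ≪ volume ∧ eLpNorm (ν.rnDeriv volume) 2 volume
      = eLpNorm (fun ξ => charFun ν (-(2 * Real.pi) • ξ)) 2 volume := by
  obtain ⟨g, hg, hgn⟩ := exists_lp_two_integral_schwartz_eq ν h
  have hac := absolutelyContinuous_of_schwartz_integral_eq hg
  refine ⟨hac, ?_⟩
  have hrn : Integrable (fun x => (ν.rnDeriv volume x).toReal) volume :=
    Measure.integrable_toReal_rnDeriv
  have hae : ∀ᵐ x ∂(volume : Measure V), ((ν.rnDeriv volume x).toReal : ℂ) = g x := by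
    refine ae_eq_of_integral_contDiff_smul_eq hrn.ofReal.locallyIntegrable
      ((Lp.memLp g).locallyIntegrable (by norm_num)) fun φ hφ hφc => ?_
    have hψc : HasCompactSupport (fun x => (φ x : ℂ)) := hφc.comp_left (g := Complex.ofReal) rfl
    have hψ : ContDiff ℝ ∞ (fun x => (φ x : ℂ)) := Complex.ofRealCLM.contDiff.comp hφ
    have h1 := hg (hψc.toSchwartzMap hψ)
    simp only [HasCompactSupport.toSchwartzMap_toFun] at h1
    simp only [Complex.real_smul]
    rw [← h1, ← integral_rnDeriv_smul hac (f := fun x => (φ x : ℂ))]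
    simp only [Complex.real_smul, mul_comm]
  rw [← hgn, Lp.enorm_def]
  refine eLpNorm_congr_enorm_ae ?_
  filter_upwards [hae, ν.rnDeriv_lt_top volume] with x hx hx'
  rw [← hx, ← ofReal_norm, Complex.norm_real, Real.norm_eq_abs, abs_of_nonneg (by positivity),
    ENNReal.ofReal_toReal hx'.ne, enorm_eq_self]

theorem eLpNorm_comp_smul {F : Type*} [NormedAddCommGroup F] (f : V → F) {c : ℝ}
    (hc : c ≠ 0) : eLpNorm (fun x => f (c • x)) 2 (volume : Measure V)
      = ENNReal.ofReal |(c ^ Module.finrank ℝ V)⁻¹| ^ (1 / 2 : ℝ) * eLpNorm f 2 volume := by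
  have hmap := Measure.map_addHaar_smul (volume : Measure V) hc
  have hem : MeasurableEmbedding (fun x : V => c • x) := measurableEmbedding_const_smul₀ hc
  have := hem.eLpNorm_map_measure (g := f) (p := 2) (μ := (volume : Measure V))
  change _ = eLpNorm (fun x => f (c • x)) 2 volume at this
  rw [← this, hmap, eLpNorm_smul_measure_of_ne_top (by norm_num), smul_eq_mul]
  simp

end Plancherel

/-! ### Gaussian regularization of the energy of a Fourier transform -/

section GaussianRegularization

open ComplexConjugate Filter Topology

/-- The Gaussian `(π / ε) ^ (3 / 2) * exp (-‖z‖² / (4 ε))` on three-space: the Fourier transform of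
`exp (-ε ‖ξ‖²)`. -/
noncomputable def gaussianKernel (ε : ℝ) (z : R3) : ℝ :=
  (Real.pi / ε) ^ (3 / 2 : ℝ) * Real.exp (-(‖z‖ ^ 2) / (4 * ε))

theorem gaussianKernel_pos {ε : ℝ} (hε : 0 < ε) (z : R3) : 0 < gaussianKernel ε z := by
  unfold gaussianKernel
  positivity

theorem continuous_gaussianKernel (ε : ℝ) : Continuous (gaussianKernel ε) := by
  unfold gaussianKernel
  fun_prop

theorem gaussianKernel_le {ε : ℝ} (hε : 0 < ε) (z : R3) :
    gaussianKernel ε z ≤ (Real.pi / ε) ^ (3 / 2 : ℝ) := by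
  unfold gaussianKernel
  refine mul_le_of_le_one_right (by positivity) (Real.exp_le_one_iff.2 ?_)
  exact div_nonpos_of_nonpos_of_nonneg (by simp) (by positivity)

theorem integral_gaussian_mul_phase {ε : ℝ} (hε : 0 < ε) (z : R3) :
    ∫ ξ : R3, (Real.exp (-ε * ‖ξ‖ ^ 2) : ℂ) *
      Complex.exp (-(Complex.I * ((inner ℝ z ξ : ℝ) : ℂ))) = (gaussianKernel ε z : ℂ) := by
  have h := GaussianFourier.integral_cexp_neg_mul_sq_norm_add (V := R3) (b := (ε : ℂ))
    (by simpa using hε) (-Complex.I) z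
  convert h using 1
  · refine integral_congr_ae (ae_of_all _ fun ξ => ?_)
    simp only [Complex.ofReal_exp, ← Complex.exp_add]
    congr 1
    push_cast
    ring
  · unfold gaussianKernel
    rw [Complex.ofReal_mul, Complex.ofReal_cpow (by positivity)]
    simp only [finrank_euclideanSpace, Fintype.card_fin]
    push_cast
    congr 2
    simp

variable {X : Type*} [MeasurableSpace X]

/-- The Fourier transform `ξ ↦ ∫ exp (-i Z(x)·ξ) h(x) dm(x)` of the image under `Z : X → ℝ³` of the
complex measure `h m`. -/
noncomputable def phaseIntegral (m : Measure X) (Z : X → R3) (h : X → ℂ) (ξ : R3) : ℂ :=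
  ∫ x, Complex.exp (-(Complex.I * ((inner ℝ (Z x) ξ : ℝ) : ℂ))) * h x ∂m

theorem norm_exp_neg_I_mul (t : ℝ) : ‖Complex.exp (-(Complex.I * (t : ℂ)))‖ = 1 := by
  rw [Complex.norm_exp]
  simp

variable {m : Measure X} {Z : X → R3}

theorem continuous_phaseIntegral (hZ : Measurable Z) {h : X → ℂ} (hh : Integrable h m) :
    Continuous (phaseIntegral m Z h) := by
  refine continuous_of_dominated (bound := fun x => ‖h x‖) (fun ξ => ?_) (fun ξ => ?_) hh.norm ?_
  · refine AEStronglyMeasurable.mul ?_ hh.aestronglyMeasurable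
    exact Measurable.aestronglyMeasurable (by fun_prop)
  · refine ae_of_all _ fun x => ?_
    rw [norm_mul, norm_exp_neg_I_mul, one_mul]
  · refine ae_of_all _ fun x => ?_
    fun_prop

theorem norm_phaseIntegral_le (h : X → ℂ) (ξ : R3) :
    ‖phaseIntegral m Z h ξ‖ ≤ ∫ x, ‖h x‖ ∂m := by
  refine (norm_integral_le_integral_norm _).trans_eq ?_
  simp only [norm_mul, norm_exp_neg_I_mul, one_mul]

theorem integrable_gaussian {ε : ℝ} (hε : 0 < ε) :
    Integrable (fun ξ : R3 => Real.exp (-ε * ‖ξ‖ ^ 2)) := by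
  have h := GaussianFourier.integrable_cexp_neg_mul_sq_norm_add (V := R3) (b := (ε : ℂ))
    (by simpa using hε) 0 0
  refine h.norm.congr (ae_of_all _ fun ξ => ?_)
  simp only [Complex.norm_exp]
  congr 1
  simp [← Complex.ofReal_pow]

/-- The Gaussian-regularized square of the `L²` norm of a function on three-space. -/
noncomputable def gaussianEnergy (ε : ℝ) (Φ : R3 → ℂ) : ℝ :=
  ∫ ξ, ‖Φ ξ‖ ^ 2 * Real.exp (-ε * ‖ξ‖ ^ 2)

/-- By Fubini's theorem, the regularized energy of a Fourier transform is a quadratic form with a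
positive kernel. -/
theorem gaussianEnergy_phaseIntegral [SFinite m] (hZ : Measurable Z) {ε : ℝ} (hε : 0 < ε)
    {h : X → ℂ} (hh : Integrable h m) :
    (gaussianEnergy ε (phaseIntegral m Z h) : ℂ)
      = ∫ p, h p.1 * conj (h p.2) * (gaussianKernel ε (Z p.1 - Z p.2) : ℂ) ∂(m.prod m) := by
  have hc : Integrable (fun x => conj (h x)) m := by
    simpa using (Complex.conjLIE.toContinuousLinearEquiv.toContinuousLinearMap.integrable_comp hh)
  have hprod : Integrable (fun p : X × X => h p.1 * conj (h p.2)) (m.prod m) := hh.mul_prod hc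
  have hF : Integrable (fun q : R3 × (X × X) =>
      ((Real.exp (-ε * ‖q.1‖ ^ 2) : ℂ) * (h q.2.1 * conj (h q.2.2))) *
        Complex.exp (-(Complex.I * ((inner ℝ (Z q.2.1 - Z q.2.2) q.1 : ℝ) : ℂ))))
      (volume.prod (m.prod m)) := by
    have h1 : Integrable (fun q : R3 × (X × X) =>
      ((Real.exp (-ε * ‖q.1‖ ^ 2) : ℂ) * (h q.2.1 * conj (h q.2.2)))) (volume.prod (m.prod m)) :=
      (integrable_gaussian hε).ofReal.mul_prod hprod
    refine h1.mul_bdd (c := 1) ?_ (ae_of_all _ fun q => ?_)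
    · exact Measurable.aestronglyMeasurable (by fun_prop)
    · rw [norm_exp_neg_I_mul]
  have hswap := integral_integral_swap (f := fun (ξ : R3) (p : X × X) =>
    ((Real.exp (-ε * ‖ξ‖ ^ 2) : ℂ) * (h p.1 * conj (h p.2))) *
        Complex.exp (-(Complex.I * ((inner ℝ (Z p.1 - Z p.2) ξ : ℝ) : ℂ)))) hF
  have hR : ∀ p : X × X, ∫ ξ : R3, ((Real.exp (-ε * ‖ξ‖ ^ 2) : ℂ) * (h p.1 * conj (h p.2))) *
        Complex.exp (-(Complex.I * ((inner ℝ (Z p.1 - Z p.2) ξ : ℝ) : ℂ)))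
      = h p.1 * conj (h p.2) * (gaussianKernel ε (Z p.1 - Z p.2) : ℂ) := by
    intro p
    rw [← integral_gaussian_mul_phase hε, ← integral_const_mul]
    congr 1
    funext ξ
    ring
  have hL : ∀ ξ : R3, ∫ p : X × X, ((Real.exp (-ε * ‖ξ‖ ^ 2) : ℂ) * (h p.1 * conj (h p.2))) *
        Complex.exp (-(Complex.I * ((inner ℝ (Z p.1 - Z p.2) ξ : ℝ) : ℂ))) ∂(m.prod m)
      = ((‖phaseIntegral m Z h ξ‖ ^ 2 * Real.exp (-ε * ‖ξ‖ ^ 2) : ℝ) : ℂ) := by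
    intro ξ
    have h2 : ((‖phaseIntegral m Z h ξ‖ ^ 2 : ℝ) : ℂ)
        = phaseIntegral m Z h ξ * conj (phaseIntegral m Z h ξ) := by
      rw [Complex.mul_conj, Complex.normSq_eq_norm_sq]
    rw [Complex.ofReal_mul, h2, phaseIntegral, ← integral_conj, ← integral_prod_mul,
      ← integral_mul_const]
    congr 1
    funext p
    simp only [map_mul, ← Complex.exp_conj, map_neg, Complex.conj_I, Complex.conj_ofReal,
      inner_sub_left, Complex.ofReal_sub]
    have : Complex.exp (-(Complex.I * (((inner ℝ (Z p.1) ξ : ℝ) : ℂ) - (inner ℝ (Z p.2) ξ : ℝ))))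
        = Complex.exp (-(Complex.I * ((inner ℝ (Z p.1) ξ : ℝ) : ℂ))) *
          Complex.exp (-(-Complex.I * ((inner ℝ (Z p.2) ξ : ℝ) : ℂ))) := by
      rw [← Complex.exp_add]
      congr 1
      ring
    rw [this]
    ring
  simp only [hL, hR] at hswap
  rw [gaussianEnergy, ← hswap, integral_complex_ofReal]

theorem gaussianEnergy_phaseIntegral_ofReal [SFinite m] (hZ : Measurable Z) {ε : ℝ} (hε : 0 < ε)
    {k : X → ℝ} (hk : Integrable k m) :
    gaussianEnergy ε (phaseIntegral m Z (fun x => (k x : ℂ)))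
      = ∫ p, k p.1 * k p.2 * gaussianKernel ε (Z p.1 - Z p.2) ∂(m.prod m) := by
  have h := gaussianEnergy_phaseIntegral hZ hε (h := fun x => (k x : ℂ)) hk.ofReal
  have h2 : ∀ p : X × X, (k p.1 : ℂ) * conj (k p.2 : ℂ) * (gaussianKernel ε (Z p.1 - Z p.2) : ℂ)
      = ((k p.1 * k p.2 * gaussianKernel ε (Z p.1 - Z p.2) : ℝ) : ℂ) := by
    intro p
    rw [Complex.conj_ofReal]
    push_cast
    ring
  simp only [h2] at h
  rw [integral_complex_ofReal] at h
  exact_mod_cast h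

theorem integrable_mul_gaussianKernel [SFinite m] (hZ : Measurable Z) {ε : ℝ} (hε : 0 < ε)
    {k l : X → ℝ} (hk : Integrable k m) (hl : Integrable l m) :
    Integrable (fun p : X × X => k p.1 * l p.2 * gaussianKernel ε (Z p.1 - Z p.2))
      (m.prod m) := by
  refine (hk.mul_prod hl).mul_bdd (c := (Real.pi / ε) ^ (3 / 2 : ℝ)) ?_ (ae_of_all _ fun p => ?_)
  · have := (continuous_gaussianKernel ε).measurable
    exact Measurable.aestronglyMeasurable (by fun_prop)
  · rw [Real.norm_of_nonneg (gaussianKernel_pos hε _).le]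
    exact gaussianKernel_le hε _

/-- Domination of densities passes to regularized energies because the kernel is positive. -/
theorem gaussianEnergy_phaseIntegral_le [SFinite m] (hZ : Measurable Z) {ε : ℝ} (hε : 0 < ε)
    {h : X → ℂ} (hh : Integrable h m) {k : X → ℝ} (hk : Integrable k m)
    (hle : ∀ x, ‖h x‖ ≤ k x) :
    gaussianEnergy ε (phaseIntegral m Z h)
      ≤ gaussianEnergy ε (phaseIntegral m Z (fun x => (k x : ℂ))) := by
  have h1 : gaussianEnergy ε (phaseIntegral m Z h)
      ≤ ‖(gaussianEnergy ε (phaseIntegral m Z h) : ℂ)‖ := by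
    rw [Complex.norm_real]
    exact Real.le_norm_self _
  refine h1.trans ?_
  rw [gaussianEnergy_phaseIntegral hZ hε hh, gaussianEnergy_phaseIntegral_ofReal hZ hε hk]
  refine norm_integral_le_of_norm_le (integrable_mul_gaussianKernel hZ hε hk hk)
    (ae_of_all _ fun p => ?_)
  rw [norm_mul, norm_mul, RCLike.norm_conj, Complex.norm_real,
    Real.norm_of_nonneg (gaussianKernel_pos hε _).le]
  have := (gaussianKernel_pos hε (Z p.1 - Z p.2)).le
  gcongr
  · exact (norm_nonneg _).trans (hle _)
  · exact hle _
  · exact hle _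

/-- The regularized energy is superadditive on nonnegative densities: the cross terms of the
quadratic form are nonnegative. -/
theorem gaussianEnergy_add_le [SFinite m] (hZ : Measurable Z) {ε : ℝ} (hε : 0 < ε)
    {k l : X → ℝ} (hk : Integrable k m) (hl : Integrable l m) (hk0 : ∀ x, 0 ≤ k x)
    (hl0 : ∀ x, 0 ≤ l x) :
    gaussianEnergy ε (phaseIntegral m Z (fun x => (k x : ℂ)))
        + gaussianEnergy ε (phaseIntegral m Z (fun x => (l x : ℂ)))
      ≤ gaussianEnergy ε (phaseIntegral m Z (fun x => ((k x + l x : ℝ) : ℂ))) := by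
  rw [gaussianEnergy_phaseIntegral_ofReal hZ hε hk, gaussianEnergy_phaseIntegral_ofReal hZ hε hl,
    gaussianEnergy_phaseIntegral_ofReal hZ hε (k := fun x => k x + l x) (hk.add hl),
    ← integral_add (integrable_mul_gaussianKernel hZ hε hk hk)
      (integrable_mul_gaussianKernel hZ hε hl hl)]
  refine integral_mono ((integrable_mul_gaussianKernel hZ hε hk hk).add
      (integrable_mul_gaussianKernel hZ hε hl hl))
    (integrable_mul_gaussianKernel hZ hε (hk.add hl) (hk.add hl)) fun p => ?_
  have hG := (gaussianKernel_pos hε (Z p.1 - Z p.2)).le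
  have h1 := mul_nonneg (mul_nonneg (hk0 p.1) (hl0 p.2)) hG
  have h2 := mul_nonneg (mul_nonneg (hl0 p.1) (hk0 p.2)) hG
  linarith

/-- Monotone convergence as the regularization is removed. -/
theorem tendsto_gaussianEnergy {Φ : R3 → ℂ} (hΦ : Continuous Φ) {C : ℝ} (hC : ∀ ξ, ‖Φ ξ‖ ≤ C) :
    Tendsto (fun n : ℕ => ENNReal.ofReal (gaussianEnergy (1 / ((n : ℝ) + 1)) Φ)) atTop
      (𝓝 (∫⁻ ξ, ‖Φ ξ‖ₑ ^ 2)) := by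
  have hpos : ∀ n : ℕ, (0 : ℝ) < 1 / ((n : ℝ) + 1) := fun n => by positivity
  have heq : ∀ n : ℕ, ENNReal.ofReal (gaussianEnergy (1 / ((n : ℝ) + 1)) Φ)
      = ∫⁻ ξ, ENNReal.ofReal (‖Φ ξ‖ ^ 2 * Real.exp (-(1 / ((n : ℝ) + 1)) * ‖ξ‖ ^ 2)) := by
    intro n
    refine ofReal_integral_eq_lintegral_ofReal ?_ (ae_of_all _ fun ξ => by positivity)
    refine (integrable_gaussian (hpos n)).bdd_mul (c := C ^ 2) ?_ (ae_of_all _ fun ξ => ?_)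
    · exact (hΦ.norm.pow 2).aestronglyMeasurable
    · rw [Real.norm_of_nonneg (by positivity)]
      gcongr
      exact hC ξ
  simp only [heq]
  refine lintegral_tendsto_of_tendsto_of_monotone (fun n => ?_) (ae_of_all _ fun ξ => ?_)
    (ae_of_all _ fun ξ => ?_)
  · exact Measurable.aemeasurable (by have := hΦ.measurable; fun_prop)
  · intro a b hab
    refine ENNReal.ofReal_le_ofReal ?_
    have hab' : (a : ℝ) ≤ b := by exact_mod_cast hab
    have h1 : (1 : ℝ) / ((b : ℝ) + 1) ≤ 1 / ((a : ℝ) + 1) := by gcongr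
    have h2 : -(1 / ((a : ℝ) + 1)) * ‖ξ‖ ^ 2 ≤ -(1 / ((b : ℝ) + 1)) * ‖ξ‖ ^ 2 := by
      have := mul_le_mul_of_nonneg_right h1 (sq_nonneg ‖ξ‖)
      linarith
    gcongr
  · have h1 : Tendsto (fun n : ℕ => (1 : ℝ) / ((n : ℝ) + 1)) atTop (𝓝 0) :=
      tendsto_one_div_add_atTop_nhds_zero_nat
    have h2 : Tendsto (fun n : ℕ => ‖Φ ξ‖ ^ 2 * Real.exp (-(1 / ((n : ℝ) + 1)) * ‖ξ‖ ^ 2)) atTop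
        (𝓝 (‖Φ ξ‖ ^ 2 * Real.exp (-0 * ‖ξ‖ ^ 2))) :=
      ((Real.continuous_exp.tendsto _).comp (h1.neg.mul_const _)).const_mul _
    have h3 := ENNReal.tendsto_ofReal h2
    simpa [ENNReal.ofReal_pow] using h3

theorem lintegral_phaseIntegral_le [SFinite m] (hZ : Measurable Z)
    {h : X → ℂ} (hh : Integrable h m) {k : X → ℝ} (hk : Integrable k m)
    (hle : ∀ x, ‖h x‖ ≤ k x) :
    ∫⁻ ξ, ‖phaseIntegral m Z h ξ‖ₑ ^ 2
      ≤ ∫⁻ ξ, ‖phaseIntegral m Z (fun x => (k x : ℂ)) ξ‖ₑ ^ 2 :=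
  le_of_tendsto_of_tendsto'
    (tendsto_gaussianEnergy (continuous_phaseIntegral hZ hh) (norm_phaseIntegral_le h))
    (tendsto_gaussianEnergy (continuous_phaseIntegral hZ hk.ofReal) (norm_phaseIntegral_le _))
    fun n => ENNReal.ofReal_le_ofReal
      (gaussianEnergy_phaseIntegral_le hZ (by positivity) hh hk hle)

theorem gaussianEnergy_nonneg (ε : ℝ) (Φ : R3 → ℂ) : 0 ≤ gaussianEnergy ε Φ :=
  integral_nonneg fun ξ => by positivity

theorem lintegral_phaseIntegral_add_le [SFinite m] (hZ : Measurable Z)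
    {k l : X → ℝ} (hk : Integrable k m) (hl : Integrable l m) (hk0 : ∀ x, 0 ≤ k x)
    (hl0 : ∀ x, 0 ≤ l x) :
    (∫⁻ ξ, ‖phaseIntegral m Z (fun x => (k x : ℂ)) ξ‖ₑ ^ 2)
        + (∫⁻ ξ, ‖phaseIntegral m Z (fun x => (l x : ℂ)) ξ‖ₑ ^ 2)
      ≤ ∫⁻ ξ, ‖phaseIntegral m Z (fun x => ((k x + l x : ℝ) : ℂ)) ξ‖ₑ ^ 2 := by
  have hT : ∀ {k : X → ℝ}, Integrable k m → Tendsto (fun n : ℕ => ENNReal.ofReal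
      (gaussianEnergy (1 / ((n : ℝ) + 1)) (phaseIntegral m Z (fun x => (k x : ℂ))))) atTop
      (𝓝 (∫⁻ ξ, ‖phaseIntegral m Z (fun x => (k x : ℂ)) ξ‖ₑ ^ 2)) := fun hk =>
    tendsto_gaussianEnergy (continuous_phaseIntegral hZ hk.ofReal) (norm_phaseIntegral_le _)
  refine le_of_tendsto_of_tendsto' ((hT hk).add (hT hl)) (hT (hk.add hl)) fun n => ?_
  rw [← ENNReal.ofReal_add (gaussianEnergy_nonneg _ _) (gaussianEnergy_nonneg _ _)]
  exact ENNReal.ofReal_le_ofReal (gaussianEnergy_add_le hZ (by positivity) hk hl hk0 hl0)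

/-- The mass is the value at frequency `0` of the Fourier transform, which is continuous. -/
theorem integral_eq_zero_of_lintegral_phaseIntegral_eq_zero (hZ : Measurable Z)
    {k : X → ℝ} (hk : Integrable k m)
    (h0 : ∫⁻ ξ, ‖phaseIntegral m Z (fun x => (k x : ℂ)) ξ‖ₑ ^ 2 = 0) : ∫ x, k x ∂m = 0 := by
  have hc := continuous_phaseIntegral hZ (h := fun x => (k x : ℂ)) hk.ofReal
  rw [lintegral_eq_zero_iff (by have := hc.measurable; fun_prop)] at h0
  have h1 : phaseIntegral m Z (fun x => (k x : ℂ)) =ᵐ[volume] fun _ => 0 := by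
    filter_upwards [h0] with ξ hξ
    simpa using hξ
  have h2 := congrFun ((hc.ae_eq_iff_eq volume continuous_const).1 h1) 0
  simp only [phaseIntegral, inner_zero_right, Complex.ofReal_zero, mul_zero, neg_zero,
    Complex.exp_zero, one_mul] at h2
  rw [integral_complex_ofReal] at h2
  exact_mod_cast h2

end GaussianRegularization

/-! ### Archimedes' hat-box theorem -/

section HatBox

open Set
open scoped Pointwise

/-- Integration in cylindrical coordinates of a function invariant under rotations about the first
axis. -/
theorem lintegral_cylindrical {H : ℝ × ℝ → ℝ≥0∞} (hH : Measurable H) :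
    ∫⁻ x : R3, H (x 0, x 1 ^ 2 + x 2 ^ 2)
      = ENNReal.ofReal (2 * Real.pi) * ∫⁻ t : ℝ, ∫⁻ s in Ioi (0 : ℝ),
          ENNReal.ofReal s * H (t, s ^ 2) := by
  have hM : MeasurePreserving (fun x : R3 => (x 0, (x 1, x 2))) (volume : Measure R3)
      ((volume : Measure ℝ).prod (volume : Measure (ℝ × ℝ))) := by
    have h1 := PiLp.volume_preserving_ofLp (Fin 3)
    have h2 := volume_preserving_piFinSuccAbove (fun _ : Fin 3 => ℝ) 0
    have h3 := (MeasurePreserving.id (volume : Measure ℝ)).prod (volume_preserving_finTwoArrow ℝ)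
    exact h3.comp (h2.comp h1)
  have h1 : ∫⁻ x : R3, H (x 0, x 1 ^ 2 + x 2 ^ 2)
      = ∫⁻ q : ℝ × (ℝ × ℝ), H (q.1, q.2.1 ^ 2 + q.2.2 ^ 2) ∂(volume.prod volume) :=
    hM.lintegral_comp (f := fun q : ℝ × (ℝ × ℝ) => H (q.1, q.2.1 ^ 2 + q.2.2 ^ 2)) (by fun_prop)
  rw [h1, lintegral_prod _ (by fun_prop), ← lintegral_const_mul _ (by fun_prop)]
  refine lintegral_congr fun t => ?_
  change ∫⁻ y : ℝ × ℝ, H (t, y.1 ^ 2 + y.2 ^ 2) = _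
  rw [← lintegral_comp_polarCoord_symm, polarCoord_target, Measure.volume_eq_prod,
    setLIntegral_prod _ (by
      simp only [polarCoord_symm_apply, smul_eq_mul]
      exact Measurable.aemeasurable (by fun_prop)),
    ← lintegral_const_mul _ (by fun_prop)]
  refine lintegral_congr fun s => ?_
  have h2 : ∀ θ : ℝ, (s * Real.cos θ) ^ 2 + (s * Real.sin θ) ^ 2 = s ^ 2 := by
    intro θ
    nlinarith [Real.sin_sq_add_cos_sq θ]
  simp only [polarCoord_symm_apply, smul_eq_mul, h2, setLIntegral_const, Real.volume_Ioo]
  rw [mul_comm]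
  congr 2
  ring

theorem lintegral_sin_mul_comp_cos (φ : ℝ → ℝ≥0∞) :
    ∫⁻ θ in Ioo 0 Real.pi, ENNReal.ofReal (Real.sin θ) * φ (Real.cos θ)
      = ∫⁻ t in Ioo (-1 : ℝ) 1, φ t := by
  have himg : Real.cos '' Ioo 0 Real.pi = Ioo (-1 : ℝ) 1 := by
    ext t
    constructor
    · rintro ⟨θ, hθ, rfl⟩
      constructor
      · rw [← Real.cos_pi]
        exact Real.cos_lt_cos_of_nonneg_of_le_pi hθ.1.le le_rfl hθ.2
      · rw [← Real.cos_zero]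
        exact Real.cos_lt_cos_of_nonneg_of_le_pi le_rfl hθ.2.le hθ.1
    · rintro ⟨h1, h2⟩
      refine ⟨Real.arccos t, ⟨Real.arccos_pos.2 h2, ?_⟩, Real.cos_arccos h1.le h2.le⟩
      exact lt_of_le_of_ne (Real.arccos_le_pi t) fun h => by
        rw [Real.arccos_eq_pi] at h
        linarith
  rw [← himg, lintegral_image_eq_lintegral_abs_deriv_mul measurableSet_Ioo
    (fun θ _ => (Real.hasDerivAt_cos θ).hasDerivWithinAt)
    (Real.injOn_cos.mono Ioo_subset_Icc_self)]
  refine setLIntegral_congr_fun measurableSet_Ioo fun θ hθ => ?_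
  simp only [abs_neg]
  rw [abs_of_pos (Real.sin_pos_of_pos_of_lt_pi hθ.1 hθ.2)]

/-- Half-plane polar coordinates evaluate the mass of a cone in cylindrical coordinates. -/
theorem lintegral_halfPlane_cone {φ : ℝ → ℝ≥0∞} (hφ : Measurable φ) :
    ∫⁻ t : ℝ, ∫⁻ s in Ioi (0 : ℝ), ENNReal.ofReal s *
        (if t ^ 2 + s ^ 2 < 1 then φ (t / Real.sqrt (t ^ 2 + s ^ 2)) else 0)
      = ENNReal.ofReal (1 / 3) * ∫⁻ t in Ioo (-1 : ℝ) 1, φ t := by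
  let K : ℝ × ℝ → ℝ≥0∞ := fun p => if 0 < p.2 then ENNReal.ofReal p.2 *
        (if p.1 ^ 2 + p.2 ^ 2 < 1 then φ (p.1 / Real.sqrt (p.1 ^ 2 + p.2 ^ 2)) else 0) else 0
  have hK : Measurable K := by
    refine Measurable.ite (measurableSet_lt measurable_const measurable_snd) ?_ measurable_const
    refine Measurable.mul (by fun_prop) ?_
    refine Measurable.ite (measurableSet_lt (by fun_prop) measurable_const) ?_ measurable_const
    fun_prop
  have h1 : ∀ t : ℝ, ∫⁻ s in Ioi (0 : ℝ), ENNReal.ofReal s *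
        (if t ^ 2 + s ^ 2 < 1 then φ (t / Real.sqrt (t ^ 2 + s ^ 2)) else 0)
      = ∫⁻ s : ℝ, K (t, s) := by
    intro t
    rw [← lintegral_indicator measurableSet_Ioi]
    refine lintegral_congr fun s => ?_
    simp [K, indicator]
  simp only [h1]
  rw [← lintegral_prod _ hK.aemeasurable, ← Measure.volume_eq_prod,
    ← lintegral_comp_polarCoord_symm, polarCoord_target, Measure.volume_eq_prod,
    setLIntegral_prod _ (by
      simp only [polarCoord_symm_apply, smul_eq_mul]
      exact Measurable.aemeasurable (by fun_prop))]
  have h2 : ∀ r ∈ Ioi (0 : ℝ), ∫⁻ θ in Ioo (-Real.pi) Real.pi,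
      ENNReal.ofReal (r, θ).1 • K (polarCoord.symm (r, θ))
      = (Ioo (0 : ℝ) 1).indicator (fun r => ENNReal.ofReal (r ^ 2)) r *
          ∫⁻ t in Ioo (-1 : ℝ) 1, φ t := by
    intro r hr
    have hr' : (0 : ℝ) < r := hr
    rw [← lintegral_sin_mul_comp_cos, ← lintegral_const_mul _ (by fun_prop)]
    rw [← lintegral_indicator measurableSet_Ioo, ← lintegral_indicator measurableSet_Ioo]
    refine lintegral_congr fun θ => ?_
    have hsq : (r * Real.cos θ) ^ 2 + (r * Real.sin θ) ^ 2 = r ^ 2 := by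
      nlinarith [Real.sin_sq_add_cos_sq θ]
    have hpi := Real.pi_pos
    by_cases hθ : θ ∈ Ioo 0 Real.pi
    · have hθ' : θ ∈ Ioo (-Real.pi) Real.pi := ⟨by linarith [hθ.1], hθ.2⟩
      have hs := Real.sin_pos_of_pos_of_lt_pi hθ.1 hθ.2
      rw [indicator_of_mem hθ, indicator_of_mem hθ']
      simp only [polarCoord_symm_apply, smul_eq_mul, K, hsq]
      rw [if_pos (by positivity), Real.sqrt_sq hr'.le, mul_div_cancel_left₀ _ hr'.ne']
      by_cases h1 : r < 1
      · rw [if_pos (by nlinarith), indicator_of_mem (show r ∈ Ioo (0 : ℝ) 1 from ⟨hr', h1⟩), ENNReal.ofReal_mul hr'.le,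
          pow_two, ENNReal.ofReal_mul hr'.le]
        ring
      · rw [if_neg (by nlinarith), indicator_of_notMem (fun h => h1 h.2)]
        simp
    · rw [indicator_of_notMem hθ]
      by_cases hθ' : θ ∈ Ioo (-Real.pi) Real.pi
      · have hs : Real.sin θ ≤ 0 := by
          refine Real.sin_nonpos_of_nonpos_of_neg_pi_le ?_ hθ'.1.le
          by_contra h
          exact hθ ⟨not_le.1 h, hθ'.2⟩
        rw [indicator_of_mem hθ']
        simp only [polarCoord_symm_apply, smul_eq_mul, K]
        rw [if_neg (by nlinarith), mul_zero]
      · rw [indicator_of_notMem hθ']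
  rw [setLIntegral_congr_fun measurableSet_Ioi h2, lintegral_mul_const _
    (Measurable.indicator (by fun_prop) measurableSet_Ioo)]
  congr 1
  rw [setLIntegral_indicator measurableSet_Ioo]
  have h3 : Ioo (0 : ℝ) 1 ∩ Ioi 0 = Ioo 0 1 := by
    ext x
    simp +contextual
  rw [h3, ← ofReal_integral_eq_lintegral_ofReal, ← integral_Ioc_eq_integral_Ioo,
    ← intervalIntegral.integral_of_le (by norm_num), integral_pow]
  · norm_num
  · exact ((continuous_pow 2).integrableOn_Icc).mono_set Ioo_subset_Icc_self
  · exact ae_of_all _ fun x => by positivity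

/-- The hat-box theorem in solid form: a degree-zero homogeneous function of one coordinate,
integrated over the unit ball. A reflection moves `e` to the first coordinate axis. -/
theorem lintegral_ball_comp_inner_div_norm {φ : ℝ → ℝ≥0∞} (hφ : Measurable φ) {e : R3}
    (he : ‖e‖ = 1) :
    ∫⁻ x : R3 in Metric.ball 0 1, φ (inner ℝ e x / ‖x‖)
      = ENNReal.ofReal (2 * Real.pi / 3) * ∫⁻ t in Ioo (-1 : ℝ) 1, φ t := by
  let e₀ : R3 := EuclideanSpace.single 0 1
  have he₀ : ‖e₀‖ = 1 := by simp [e₀]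
  let L : R3 ≃ₗᵢ[ℝ] R3 := ((ℝ ∙ (e₀ - e))ᗮ).reflection
  have hL : L e₀ = e := Submodule.reflection_sub (by rw [he₀, he])
  have hinner : ∀ x : R3, inner ℝ e (L x) = x 0 := by
    intro x
    rw [← hL, LinearIsometryEquiv.inner_map_map]
    simp [e₀, EuclideanSpace.inner_single_left]
  have hnorm : ∀ x : R3, ‖x‖ ^ 2 = x 0 ^ 2 + (x 1 ^ 2 + x 2 ^ 2) := by
    intro x
    rw [EuclideanSpace.real_norm_sq_eq, Fin.sum_univ_three]
    ring
  let H : ℝ × ℝ → ℝ≥0∞ := fun p =>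
    if p.1 ^ 2 + p.2 < 1 then φ (p.1 / Real.sqrt (p.1 ^ 2 + p.2)) else 0
  have hH : Measurable H := by
    refine Measurable.ite (measurableSet_lt (by fun_prop) measurable_const) ?_ measurable_const
    fun_prop
  have h1 : ∫⁻ x : R3 in Metric.ball 0 1, φ (inner ℝ e x / ‖x‖)
      = ∫⁻ x : R3, H (x 0, x 1 ^ 2 + x 2 ^ 2) := by
    rw [← lintegral_indicator Metric.isOpen_ball.measurableSet,
      ← L.measurePreserving.lintegral_comp
        (Measurable.indicator (by fun_prop) Metric.isOpen_ball.measurableSet)]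
    refine lintegral_congr fun x => ?_
    simp only [indicator, mem_ball_zero_iff, LinearIsometryEquiv.norm_map, hinner, H, ← hnorm,
      Real.sqrt_sq (norm_nonneg x)]
    simp only [sq_lt_one_iff₀ (norm_nonneg x)]
  rw [h1, lintegral_cylindrical hH]
  simp only [H]
  rw [lintegral_halfPlane_cone hφ, ← mul_assoc, ← ENNReal.ofReal_mul (by positivity)]
  congr 2
  ring

/-- Archimedes' hat-box theorem: the image of surface measure under a coordinate function is a
multiple of Lebesgue measure on `(-1, 1)`. -/
theorem lintegral_surfaceMeasure_inner {φ : ℝ → ℝ≥0∞} (hφ : Measurable φ) {e : R3}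
    (he : ‖e‖ = 1) :
    ∫⁻ b : S2, φ (inner ℝ e (b : R3)) ∂surfaceMeasure
      = ENNReal.ofReal (2 * Real.pi) * ∫⁻ t in Ioo (-1 : ℝ) 1, φ t := by
  have hp : Measurable (fun b : S2 => (inner ℝ e (b : R3) : ℝ)) := by fun_prop
  have hq : Measurable (fun x : R3 => (inner ℝ e x / ‖x‖ : ℝ)) := by fun_prop
  have hmap : surfaceMeasure.map (fun b : S2 => (inner ℝ e (b : R3) : ℝ))
      = (3 : ℝ≥0∞) • ((volume : Measure R3).restrict (Metric.ball 0 1)).map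
          (fun x : R3 => (inner ℝ e x / ‖x‖ : ℝ)) := by
    ext s hs
    rw [Measure.map_apply hp hs, Measure.smul_apply, Measure.map_apply hq hs,
      Measure.restrict_apply (hq hs), surfaceMeasure, Measure.toSphere_apply' _ (hp hs)]
    simp only [finrank_euclideanSpace, Fintype.card_fin, smul_eq_mul]
    congr 1
    -- The cone over a subset of the sphere is its radial preimage in the punctured ball.
    have hset : (Ioo (0 : ℝ) 1 • ((fun b : S2 => (b : R3)) ''
          ((fun b : S2 => (inner ℝ e (b : R3) : ℝ)) ⁻¹' s)))
        = ((fun x : R3 => (inner ℝ e x / ‖x‖ : ℝ)) ⁻¹' s ∩ Metric.ball 0 1) \ {0} := by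
      ext x
      constructor
      · rintro ⟨r, hr, _, ⟨b, hb, rfl⟩, rfl⟩
        have hbn : ‖(b : R3)‖ = 1 := by simp
        have hrn : ‖r • (b : R3)‖ = r := by
          rw [norm_smul, hbn, mul_one, Real.norm_of_nonneg hr.1.le]
        refine ⟨⟨?_, ?_⟩, ?_⟩
        · simp only [mem_preimage, hrn, inner_smul_right]
          rw [mul_div_cancel_left₀ _ hr.1.ne']
          exact hb
        · simpa [hrn] using hr.2
        · intro h
          have : ‖r • (b : R3)‖ = 0 := by
            rw [mem_singleton_iff] at h
            change ‖(fun x1 x2 => x1 • x2) r (b : R3)‖ = 0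
            rw [h, norm_zero]
          rw [hrn] at this
          exact hr.1.ne' this
      · rintro ⟨⟨hx1, hx2⟩, hx3⟩
        have hx0 : x ≠ 0 := hx3
        have hn : 0 < ‖x‖ := norm_pos_iff.2 hx0
        refine ⟨‖x‖, ⟨hn, by simpa using hx2⟩, ‖x‖⁻¹ • x,
          ⟨⟨‖x‖⁻¹ • x, by simp [norm_smul, hn.ne']⟩, ?_, rfl⟩, ?_⟩
        · simp only [mem_preimage, inner_smul_right]
          rw [mem_preimage, div_eq_inv_mul] at hx1
          exact hx1
        · simp [smul_smul, hn.ne']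
    rw [hset, measure_sdiff_null (by simp)]
  rw [← lintegral_map hφ hp, hmap, lintegral_smul_measure, lintegral_map hφ hq,
    lintegral_ball_comp_inner_div_norm hφ he, smul_eq_mul, ← mul_assoc]
  congr 1
  rw [show (3 : ℝ≥0∞) = ENNReal.ofReal 3 by simp, ← ENNReal.ofReal_mul (by norm_num)]
  congr 1
  ring

end HatBox

/-! ### Convolution of surface measure with Gaussians -/

section KernelBound

open Set

/-- The hat-box theorem, rewritten for radial functions of a translate of the sphere. -/
theorem lintegral_surfaceMeasure_norm_add_le {ψ : ℝ → ℝ≥0∞} (hψ : Measurable ψ) {z : R3}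
    (hz : z ≠ 0) :
    ∫⁻ b : S2, ψ ‖z + b‖ ∂surfaceMeasure
      ≤ ENNReal.ofReal (2 * Real.pi / ‖z‖) *
          ∫⁻ r in Ioi |‖z‖ - 1|, ENNReal.ofReal r * ψ r := by
  have hR : 0 < ‖z‖ := norm_pos_iff.2 hz
  set R := ‖z‖ with hRdef
  have he : ‖R⁻¹ • z‖ = 1 := by
    rw [norm_smul, norm_inv, norm_norm, ← hRdef, inv_mul_cancel₀ hR.ne']
  have hnorm : ∀ b : S2, ‖z + b‖ = Real.sqrt (R ^ 2 + 1 + 2 * R * inner ℝ (R⁻¹ • z) (b : R3)) := by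
    intro b
    have hb : ‖(b : R3)‖ = 1 := by simp
    rw [← Real.sqrt_sq (norm_nonneg (z + (b : R3))), norm_add_sq_real, hb, real_inner_smul_left,
      ← hRdef]
    congr 1
    field_simp
    ring
  simp only [hnorm]
  rw [lintegral_surfaceMeasure_inner
    (φ := fun t => ψ (Real.sqrt (R ^ 2 + 1 + 2 * R * t))) (by fun_prop) he]
  -- Substitute `r = ‖z + b‖`, that is `r ^ 2 = R ^ 2 + 1 + 2 R t`.
  let f : ℝ → ℝ := fun r => (r ^ 2 - R ^ 2 - 1) / (2 * R)
  have habs : 0 ≤ |R - 1| := abs_nonneg _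
  have himg : Ioo (-1 : ℝ) 1 ⊆ f '' Ioi |R - 1| := by
    rintro t ⟨ht1, ht2⟩
    have hlt : |R - 1| ^ 2 < R ^ 2 + 1 + 2 * R * t := by
      rw [sq_abs]
      nlinarith
    refine ⟨Real.sqrt (R ^ 2 + 1 + 2 * R * t), Real.lt_sqrt_of_sq_lt hlt, ?_⟩
    simp only [f]
    rw [Real.sq_sqrt ((sq_nonneg _).trans hlt.le)]
    field_simp
    ring
  have hder : ∀ r ∈ Ioi |R - 1|, HasDerivWithinAt f (r / R) (Ioi |R - 1|) r := by
    intro r _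
    have h1 := ((((hasDerivAt_id r).pow 2).sub_const (R ^ 2)).sub_const 1).div_const (2 * R)
    refine HasDerivAt.hasDerivWithinAt ?_
    refine h1.congr_deriv ?_
    simp only [id]
    field_simp
    norm_num
  have hinj : InjOn f (Ioi |R - 1|) := by
    intro a ha b hb hab
    have ha' : 0 < a := habs.trans_lt ha
    have hb' : 0 < b := habs.trans_lt hb
    simp only [f] at hab
    rw [div_left_inj' (by positivity)] at hab
    nlinarith
  calc ENNReal.ofReal (2 * Real.pi) *
        ∫⁻ t in Ioo (-1 : ℝ) 1, ψ (Real.sqrt (R ^ 2 + 1 + 2 * R * t))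
      ≤ ENNReal.ofReal (2 * Real.pi) *
        ∫⁻ t in f '' Ioi |R - 1|, ψ (Real.sqrt (R ^ 2 + 1 + 2 * R * t)) := by
        gcongr
    _ = ENNReal.ofReal (2 * Real.pi) *
        ∫⁻ r in Ioi |R - 1|, ENNReal.ofReal R⁻¹ * (ENNReal.ofReal r * ψ r) := by
        rw [lintegral_image_eq_lintegral_abs_deriv_mul measurableSet_Ioi hder hinj]
        congr 1
        refine setLIntegral_congr_fun measurableSet_Ioi fun r hr => ?_
        have hr' : 0 < r := habs.trans_lt hr
        have h1 : R ^ 2 + 1 + 2 * R * f r = r ^ 2 := by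
          simp only [f]
          field_simp
          ring
        simp only [h1, Real.sqrt_sq hr'.le]
        rw [abs_of_pos (by positivity), div_eq_inv_mul, ENNReal.ofReal_mul (by positivity),
          mul_assoc]
    _ = _ := by
        rw [lintegral_const_mul _ (by fun_prop), ← mul_assoc, ← ENNReal.ofReal_mul (by positivity),
          div_eq_mul_inv]

theorem lintegral_Ioi_id_mul_gaussian {ε : ℝ} (hε : 0 < ε) {c : ℝ} (hc : 0 ≤ c) :
    ∫⁻ r in Ioi c, ENNReal.ofReal r * ENNReal.ofReal (Real.exp (-(r ^ 2) / (4 * ε)))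
      = ENNReal.ofReal (2 * ε * Real.exp (-(c ^ 2) / (4 * ε))) := by
  have hder : ∀ r ∈ Ioi c, HasDerivAt (fun r : ℝ => -(2 * ε) * Real.exp (-(r ^ 2) / (4 * ε)))
      (r * Real.exp (-(r ^ 2) / (4 * ε))) r := by
    intro r _
    have h1 := ((((hasDerivAt_id r).pow 2).neg.div_const (4 * ε)).exp).const_mul (-(2 * ε))
    refine h1.congr_deriv ?_
    simp only [id, Pi.neg_apply, Pi.pow_apply]
    field_simp
    norm_num
    ring
  have hcont : ContinuousWithinAt (fun r : ℝ => -(2 * ε) * Real.exp (-(r ^ 2) / (4 * ε)))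
      (Ici c) c := by
    apply Continuous.continuousWithinAt
    fun_prop
  have hnn : ∀ r ∈ Ioi c, 0 ≤ r * Real.exp (-(r ^ 2) / (4 * ε)) := fun r hr =>
    mul_nonneg (hc.trans (le_of_lt hr)) (Real.exp_pos _).le
  have hlim : Filter.Tendsto (fun r : ℝ => -(2 * ε) * Real.exp (-(r ^ 2) / (4 * ε)))
      Filter.atTop (nhds 0) := by
    have h1 : Filter.Tendsto (fun r : ℝ => -(r ^ 2) / (4 * ε)) Filter.atTop Filter.atBot :=
      (Filter.tendsto_neg_atTop_atBot.comp
        (Filter.tendsto_pow_atTop (by norm_num))).atBot_div_const (by positivity)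
    simpa using (Real.tendsto_exp_atBot.comp h1).const_mul (-(2 * ε))
  have hI := integral_Ioi_of_hasDerivAt_of_nonneg hcont hder hnn hlim
  have hint := integrableOn_Ioi_deriv_of_nonneg hcont hder hnn hlim
  have h2 := ofReal_integral_eq_lintegral_ofReal hint
    ((ae_restrict_iff' measurableSet_Ioi).2 (ae_of_all _ hnn))
  rw [hI] at h2
  rw [show 2 * ε * Real.exp (-(c ^ 2) / (4 * ε))
    = 0 - -(2 * ε) * Real.exp (-(c ^ 2) / (4 * ε)) by ring, h2]
  refine setLIntegral_congr_fun measurableSet_Ioi fun r hr => ?_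
  exact (ENNReal.ofReal_mul (hc.trans (le_of_lt hr))).symm

/-- The Gaussian kernel integrated over a translate of the sphere. Division by zero makes the
bound infinite at `z = 0`. -/
theorem lintegral_gaussianKernel_sphere_le {ε : ℝ} (hε : 0 < ε) (z : R3) :
    ∫⁻ b : S2, ENNReal.ofReal (gaussianKernel ε (z + b)) ∂surfaceMeasure
      ≤ ENNReal.ofReal (2 * Real.pi * (Real.pi / ε) ^ (3 / 2 : ℝ) * (2 * ε) *
          Real.exp (-((‖z‖ - 1) ^ 2) / (4 * ε))) / ENNReal.ofReal ‖z‖ := by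
  by_cases hz : z = 0
  · subst hz
    rw [norm_zero, ENNReal.ofReal_zero, ENNReal.div_zero]
    · exact le_top
    · exact (ENNReal.ofReal_pos.2 (by positivity)).ne'
  have hR : 0 < ‖z‖ := norm_pos_iff.2 hz
  have h1 := lintegral_surfaceMeasure_norm_add_le
    (ψ := fun r => ENNReal.ofReal ((Real.pi / ε) ^ (3 / 2 : ℝ)) *
      ENNReal.ofReal (Real.exp (-(r ^ 2) / (4 * ε)))) (by fun_prop) hz
  have h2 : ∀ b : S2, ENNReal.ofReal (gaussianKernel ε (z + b))
      = ENNReal.ofReal ((Real.pi / ε) ^ (3 / 2 : ℝ)) *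
      ENNReal.ofReal (Real.exp (-(‖z + b‖ ^ 2) / (4 * ε))) := fun b =>
    ENNReal.ofReal_mul (by positivity)
  simp only [h2]
  refine h1.trans_eq ?_
  simp only [mul_left_comm (ENNReal.ofReal _) (ENNReal.ofReal ((Real.pi / ε) ^ (3 / 2 : ℝ)))]
  rw [lintegral_const_mul _ (by fun_prop), lintegral_Ioi_id_mul_gaussian hε (abs_nonneg _), sq_abs,
    ← ENNReal.ofReal_mul (by positivity), ← ENNReal.ofReal_mul (by positivity),
    ← ENNReal.ofReal_div_of_pos hR]
  congr 1
  ring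

theorem lintegral_shifted_gaussian {ε : ℝ} (hε : 0 < ε) :
    ∫⁻ r : ℝ, ENNReal.ofReal (Real.exp (-((r - 1) ^ 2) / (4 * ε)))
      = ENNReal.ofReal (Real.sqrt (4 * Real.pi * ε)) := by
  rw [lintegral_sub_right_eq_self
    (fun r : ℝ => ENNReal.ofReal (Real.exp (-(r ^ 2) / (4 * ε)))) 1]
  have h1 : ∀ r : ℝ, Real.exp (-(r ^ 2) / (4 * ε)) = Real.exp (-(1 / (4 * ε)) * r ^ 2) := by
    intro r
    congr 1
    field_simp
  simp only [h1]
  rw [← ofReal_integral_eq_lintegral_ofReal (integrable_exp_neg_mul_sq (by positivity))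
    (ae_of_all _ fun r => (Real.exp_pos _).le), integral_gaussian]
  congr 2
  field_simp

/-- The convolution of two copies of surface measure with the Gaussian kernel is bounded away from
the origin, uniformly in the width of the Gaussian (`σ * σ` has density `2π / ‖x‖` for
`‖x‖ < 2`, and the kernel has mass `(2π) ^ 3`). -/
theorem lintegral_lintegral_gaussianKernel_le {ε : ℝ} (hε : 0 < ε) {x : R3} (hx : 1 / 2 ≤ ‖x‖) :
    ∫⁻ a : S2, ∫⁻ b : S2, ENNReal.ofReal (gaussianKernel ε (x + a + b)) ∂surfaceMeasure
      ∂surfaceMeasure ≤ ENNReal.ofReal (32 * Real.pi ^ 4) := by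
  have hx0 : x ≠ 0 := norm_pos_iff.1 (by linarith)
  set c : ℝ := 2 * Real.pi * (Real.pi / ε) ^ (3 / 2 : ℝ) * (2 * ε) with hc
  have hc0 : 0 ≤ c := by positivity
  calc ∫⁻ a : S2, ∫⁻ b : S2, ENNReal.ofReal (gaussianKernel ε (x + a + b)) ∂surfaceMeasure
        ∂surfaceMeasure
      ≤ ∫⁻ a : S2, ENNReal.ofReal (c * Real.exp (-((‖x + a‖ - 1) ^ 2) / (4 * ε)))
          / ENNReal.ofReal ‖x + a‖ ∂surfaceMeasure :=
        lintegral_mono fun a => lintegral_gaussianKernel_sphere_le hε _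
    _ ≤ ENNReal.ofReal (2 * Real.pi / ‖x‖) * ∫⁻ r in Ioi |‖x‖ - 1|, ENNReal.ofReal r *
          (ENNReal.ofReal (c * Real.exp (-((r - 1) ^ 2) / (4 * ε))) / ENNReal.ofReal r) :=
        lintegral_surfaceMeasure_norm_add_le
          (ψ := fun r => ENNReal.ofReal (c * Real.exp (-((r - 1) ^ 2) / (4 * ε)))
            / ENNReal.ofReal r) (by fun_prop) hx0
    _ = ENNReal.ofReal (2 * Real.pi / ‖x‖) * ∫⁻ r in Ioi |‖x‖ - 1|,
          ENNReal.ofReal c * ENNReal.ofReal (Real.exp (-((r - 1) ^ 2) / (4 * ε))) := by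
        congr 1
        refine setLIntegral_congr_fun measurableSet_Ioi fun r hr => ?_
        have hr' : 0 < r := (abs_nonneg _).trans_lt hr
        rw [ENNReal.mul_div_cancel (ENNReal.ofReal_pos.2 hr').ne' ENNReal.ofReal_ne_top,
          ENNReal.ofReal_mul hc0]
    _ ≤ ENNReal.ofReal (2 * Real.pi / ‖x‖) * ∫⁻ r : ℝ,
          ENNReal.ofReal c * ENNReal.ofReal (Real.exp (-((r - 1) ^ 2) / (4 * ε))) := by
        gcongr
        exact Measure.restrict_le_self
    _ = ENNReal.ofReal (2 * Real.pi / ‖x‖ * (c * Real.sqrt (4 * Real.pi * ε))) := by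
        rw [lintegral_const_mul _ (by fun_prop), lintegral_shifted_gaussian hε,
          ← ENNReal.ofReal_mul hc0, ← ENNReal.ofReal_mul (by positivity)]
    _ ≤ _ := by
        refine ENNReal.ofReal_le_ofReal ?_
        have h32 : (Real.pi / ε) ^ (3 / 2 : ℝ) = Real.pi / ε * Real.sqrt (Real.pi / ε) := by
          rw [show (3 / 2 : ℝ) = 1 + 1 / 2 by norm_num, Real.rpow_add (by positivity),
            Real.rpow_one, Real.sqrt_eq_rpow]
        have hs : Real.sqrt (Real.pi / ε) * Real.sqrt (4 * Real.pi * ε) = 2 * Real.pi := by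
          rw [← Real.sqrt_mul (by positivity),
            show Real.pi / ε * (4 * Real.pi * ε) = (2 * Real.pi) ^ 2 by field_simp; norm_num,
            Real.sqrt_sq (by positivity)]
        have h3 : c * Real.sqrt (4 * Real.pi * ε) = 8 * Real.pi ^ 3 := by
          rw [hc, h32]
          calc 2 * Real.pi * (Real.pi / ε * Real.sqrt (Real.pi / ε)) * (2 * ε) *
                Real.sqrt (4 * Real.pi * ε)
              = 4 * Real.pi ^ 2 * (Real.sqrt (Real.pi / ε) * Real.sqrt (4 * Real.pi * ε)) := by
                field_simp
                ring
            _ = _ := by rw [hs]; ring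
        rw [h3]
        have h4 : 2 * Real.pi / ‖x‖ ≤ 4 * Real.pi := by
          rw [div_le_iff₀ (by linarith)]
          nlinarith [Real.pi_pos]
        calc 2 * Real.pi / ‖x‖ * (8 * Real.pi ^ 3) ≤ 4 * Real.pi * (8 * Real.pi ^ 3) := by gcongr
          _ = _ := by ring

theorem gaussianKernel_le_of_half_lt_norm {ε : ℝ} (hε : 0 < ε) (hε1 : ε ≤ 1) {z : R3}
    (hz : 1 / 2 < ‖z‖) : gaussianKernel ε z ≤ 512 * Real.pi ^ 2 := by
  have h1 : (Real.pi / ε) ^ (3 / 2 : ℝ) ≤ (Real.pi / ε) ^ (2 : ℝ) := by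
    refine Real.rpow_le_rpow_of_exponent_le ?_ (by norm_num)
    rw [le_div_iff₀ hε]
    linarith [Real.pi_gt_three]
  have h2 : Real.exp (-(‖z‖ ^ 2) / (4 * ε)) ≤ 512 * ε ^ 2 := by
    have h3 : Real.exp (-(‖z‖ ^ 2) / (4 * ε)) ≤ Real.exp (-(1 / (16 * ε))) := by
      refine Real.exp_le_exp.2 ?_
      rw [neg_div, neg_le_neg_iff, div_le_div_iff₀ (by positivity) (by positivity)]
      have hz2 : 1 / 4 < ‖z‖ ^ 2 := by nlinarith
      nlinarith [mul_lt_mul_of_pos_left hz2 hε]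
    have h4 : (1 / (16 * ε)) ^ 2 / 2 ≤ Real.exp (1 / (16 * ε)) := by
      have h0 : (0 : ℝ) < 1 / (16 * ε) := by positivity
      nlinarith [Real.quadratic_le_exp_of_nonneg h0.le]
    refine h3.trans ?_
    rw [Real.exp_neg, inv_le_comm₀ (Real.exp_pos _) (by positivity)]
    refine le_trans (le_of_eq ?_) h4
    field_simp
    norm_num
  unfold gaussianKernel
  calc (Real.pi / ε) ^ (3 / 2 : ℝ) * Real.exp (-(‖z‖ ^ 2) / (4 * ε))
      ≤ (Real.pi / ε) ^ (2 : ℝ) * (512 * ε ^ 2) := by gcongr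
    _ = _ := by
      rw [Real.rpow_two]
      field_simp

end KernelBound

/-! ### A quadrilinear bound on the sphere -/

section QuadrilinearBound

instance : IsFiniteMeasure surfaceMeasure := by
  unfold surfaceMeasure
  infer_instance

section Permutations

variable {X : Type*} [MeasurableSpace X] {μ : Measure X} {F : X × X × X × X → ℝ≥0∞}

theorem lintegral_four_mul (C : ℝ≥0∞) {w : X → ℝ≥0∞} (hw : Measurable w) :
    ∫⁻ a, ∫⁻ b, ∫⁻ c, ∫⁻ d, C * w a * w b * w c * w d ∂μ ∂μ ∂μ ∂μ = C * (∫⁻ a, w a ∂μ) ^ 4 := by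
  have h : ∀ y z : ℝ≥0∞, ∫⁻ c, y * w c * z ∂μ = y * ((∫⁻ c, w c ∂μ) * z) := by
    intro y z
    rw [lintegral_mul_const _ (hw.const_mul y), lintegral_const_mul _ hw, mul_assoc]
  simp only [lintegral_const_mul _ hw, h]
  ring

variable [SFinite μ]

theorem lintegral_four_swap_left (hF : Measurable F) :
    ∫⁻ a, ∫⁻ b, ∫⁻ c, ∫⁻ d, F (b, a, c, d) ∂μ ∂μ ∂μ ∂μ
      = ∫⁻ a, ∫⁻ b, ∫⁻ c, ∫⁻ d, F (a, b, c, d) ∂μ ∂μ ∂μ ∂μ := by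
  refine lintegral_lintegral_swap (f := fun a b => ∫⁻ c, ∫⁻ d, F (b, a, c, d) ∂μ ∂μ) ?_
  exact Measurable.aemeasurable (by fun_prop)

theorem lintegral_four_swap_middle (hF : Measurable F) :
    ∫⁻ a, ∫⁻ b, ∫⁻ c, ∫⁻ d, F (a, c, b, d) ∂μ ∂μ ∂μ ∂μ
      = ∫⁻ a, ∫⁻ b, ∫⁻ c, ∫⁻ d, F (a, b, c, d) ∂μ ∂μ ∂μ ∂μ := by
  refine lintegral_congr fun a => ?_
  refine lintegral_lintegral_swap (f := fun b c => ∫⁻ d, F (a, c, b, d) ∂μ) ?_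
  exact Measurable.aemeasurable (by fun_prop)

theorem lintegral_four_swap_right (hF : Measurable F) :
    ∫⁻ a, ∫⁻ b, ∫⁻ c, ∫⁻ d, F (a, b, d, c) ∂μ ∂μ ∂μ ∂μ
      = ∫⁻ a, ∫⁻ b, ∫⁻ c, ∫⁻ d, F (a, b, c, d) ∂μ ∂μ ∂μ ∂μ := by
  refine lintegral_congr fun a => lintegral_congr fun b => ?_
  refine lintegral_lintegral_swap (f := fun c d => F (a, b, d, c)) ?_
  exact Measurable.aemeasurable (by fun_prop)

theorem lintegral_four_swap_pairs (hF : Measurable F) :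
    ∫⁻ a, ∫⁻ b, ∫⁻ c, ∫⁻ d, F (c, d, a, b) ∂μ ∂μ ∂μ ∂μ
      = ∫⁻ a, ∫⁻ b, ∫⁻ c, ∫⁻ d, F (a, b, c, d) ∂μ ∂μ ∂μ ∂μ := by
  rw [← lintegral_four_swap_middle hF,
    ← lintegral_four_swap_left (F := fun q => F (q.1, q.2.2.1, q.2.1, q.2.2.2)) (by fun_prop),
    ← lintegral_four_swap_right (F := fun q => F (q.2.1, q.2.2.1, q.1, q.2.2.2)) (by fun_prop),
    ← lintegral_four_swap_middle (F := fun q => F (q.2.1, q.2.2.2, q.1, q.2.2.1)) (by fun_prop)]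

theorem lintegral_four_add {G : X × X × X × X → ℝ≥0∞} (hF : Measurable F) :
    ∫⁻ a, ∫⁻ b, ∫⁻ c, ∫⁻ d, (F (a, b, c, d) + G (a, b, c, d)) ∂μ ∂μ ∂μ ∂μ
      = (∫⁻ a, ∫⁻ b, ∫⁻ c, ∫⁻ d, F (a, b, c, d) ∂μ ∂μ ∂μ ∂μ)
        + ∫⁻ a, ∫⁻ b, ∫⁻ c, ∫⁻ d, G (a, b, c, d) ∂μ ∂μ ∂μ ∂μ := by
  rw [← lintegral_add_left (by fun_prop)]
  refine lintegral_congr fun a => ?_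
  rw [← lintegral_add_left (by fun_prop)]
  refine lintegral_congr fun b => ?_
  rw [← lintegral_add_left (by fun_prop)]
  refine lintegral_congr fun c => ?_
  rw [← lintegral_add_left (by fun_prop)]

end Permutations

/-- If four unit vectors have a small sum, then they split into two pairs neither of which is
nearly antipodal. -/
theorem exists_pairing_of_norm_add_le (a b c d : S2) (h : ‖(a + b + c + d : R3)‖ ≤ 1 / 2) :
    (1 / 2 ≤ ‖(a + b : R3)‖ ∧ 1 / 2 ≤ ‖(c + d : R3)‖) ∨
      (1 / 2 ≤ ‖(a + c : R3)‖ ∧ 1 / 2 ≤ ‖(b + d : R3)‖) ∨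
      (1 / 2 ≤ ‖(b + c : R3)‖ ∧ 1 / 2 ≤ ‖(a + d : R3)‖) := by
  have hn : ∀ x : S2, ‖(x : R3)‖ = 1 := fun x => by simp
  have hab := norm_add_sq_real (a : R3) b
  have hac := norm_add_sq_real (a : R3) c
  have hbc := norm_add_sq_real (b : R3) c
  have habc := norm_add_sq_real (a + b : R3) c
  rw [inner_add_left] at habc
  rw [hn, hn] at hab hac hbc
  rw [hn] at habc
  -- For unit vectors, `‖a + b‖² + ‖a + c‖² + ‖b + c‖² = 3 + ‖a + b + c‖²`.
  have hsum : 3 ≤ ‖(a + b : R3)‖ ^ 2 + ‖(a + c : R3)‖ ^ 2 + ‖(b + c : R3)‖ ^ 2 := by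
    nlinarith [sq_nonneg ‖(a + b + c : R3)‖]
  have key : ∀ u v : R3, ‖u + v‖ ≤ 1 / 2 → 1 ≤ ‖u‖ ^ 2 → 1 / 2 ≤ ‖u‖ ∧ 1 / 2 ≤ ‖v‖ := by
    intro u v huv hu
    have h1 : 1 ≤ ‖u‖ := by nlinarith [norm_nonneg u]
    have h2 : ‖u‖ ≤ ‖u + v‖ + ‖v‖ := by simpa using norm_sub_le (u + v) v
    constructor <;> linarith
  by_cases h1 : 1 ≤ ‖(a + b : R3)‖ ^ 2
  · exact Or.inl (key _ _ (by rwa [← add_assoc]) h1)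
  by_cases h2 : 1 ≤ ‖(a + c : R3)‖ ^ 2
  · refine Or.inr (Or.inl (key _ _ ?_ h2))
    rwa [show (a + c + (b + d) : R3) = a + b + c + d by abel]
  · refine Or.inr (Or.inr (key _ _ ?_ (by linarith)))
    rwa [show (b + c + (a + d) : R3) = a + b + c + d by abel]

variable {w : S2 → ℝ≥0∞}

open Classical in
/-- The square of the weight of a pair that is not nearly antipodal, times the Gaussian kernel. -/
noncomputable def pairSquare (ε : ℝ) (w : S2 → ℝ≥0∞) (q : S2 × S2 × S2 × S2) : ℝ≥0∞ :=
  (if 1 / 2 ≤ ‖(q.1 + q.2.1 : R3)‖ then w q.1 ^ 2 * w q.2.1 ^ 2 else 0) *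
    ENNReal.ofReal (gaussianKernel ε (q.1 + q.2.1 + q.2.2.1 + q.2.2.2))

open Classical in
/-- The quadrilinear integrand, restricted to pairings neither of whose pairs is nearly
antipodal. -/
noncomputable def pairedIntegrand (ε : ℝ) (w : S2 → ℝ≥0∞) (q : S2 × S2 × S2 × S2) : ℝ≥0∞ :=
  if 1 / 2 ≤ ‖(q.1 + q.2.1 : R3)‖ ∧ 1 / 2 ≤ ‖(q.2.2.1 + q.2.2.2 : R3)‖ then
    w q.1 * w q.2.1 * w q.2.2.1 * w q.2.2.2 *
      ENNReal.ofReal (gaussianKernel ε (q.1 + q.2.1 + q.2.2.1 + q.2.2.2)) else 0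

theorem measurable_pairSquare (ε : ℝ) (hw : Measurable w) : Measurable (pairSquare ε w) := by
  have := (continuous_gaussianKernel ε).measurable
  refine Measurable.mul (Measurable.ite ?_ (by fun_prop) measurable_const) (by fun_prop)
  exact measurableSet_le (by fun_prop) (by fun_prop)

theorem measurable_pairedIntegrand (ε : ℝ) (hw : Measurable w) :
    Measurable (pairedIntegrand ε w) := by
  have := (continuous_gaussianKernel ε).measurable
  refine Measurable.ite ?_ (by fun_prop) measurable_const
  have h1 : MeasurableSet {q : S2 × S2 × S2 × S2 | 1 / 2 ≤ ‖(q.1 + q.2.1 : R3)‖} :=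
    measurableSet_le (by fun_prop) (by fun_prop)
  have h2 : MeasurableSet {q : S2 × S2 × S2 × S2 | 1 / 2 ≤ ‖(q.2.2.1 + q.2.2.2 : R3)‖} :=
    measurableSet_le (by fun_prop) (by fun_prop)
  exact h1.inter h2

theorem lintegral_pairSquare_le {ε : ℝ} (hε : 0 < ε) (hw : Measurable w) :
    ∫⁻ a, ∫⁻ b, ∫⁻ c, ∫⁻ d, pairSquare ε w (a, b, c, d) ∂surfaceMeasure ∂surfaceMeasure
        ∂surfaceMeasure ∂surfaceMeasure
      ≤ ENNReal.ofReal (32 * Real.pi ^ 4) * (∫⁻ a, w a ^ 2 ∂surfaceMeasure) ^ 2 := by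
  have hk := (continuous_gaussianKernel ε).measurable
  calc _ ≤ ∫⁻ a, ∫⁻ b, ENNReal.ofReal (32 * Real.pi ^ 4) * w a ^ 2 * w b ^ 2 ∂surfaceMeasure
          ∂surfaceMeasure := by
        refine lintegral_mono fun a => lintegral_mono fun b => ?_
        simp only [pairSquare]
        split_ifs with h
        · have h1 := lintegral_lintegral_gaussianKernel_le hε h
          calc ∫⁻ c : S2, ∫⁻ d : S2, w a ^ 2 * w b ^ 2 *
                ENNReal.ofReal (gaussianKernel ε (a + b + c + d)) ∂surfaceMeasure ∂surfaceMeasure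
              = w a ^ 2 * w b ^ 2 * ∫⁻ c : S2, ∫⁻ d : S2,
                ENNReal.ofReal (gaussianKernel ε (a + b + c + d)) ∂surfaceMeasure
                  ∂surfaceMeasure := by
                rw [← lintegral_const_mul _ (by fun_prop)]
                refine lintegral_congr fun c => ?_
                rw [← lintegral_const_mul _ (by fun_prop)]
            _ ≤ w a ^ 2 * w b ^ 2 * ENNReal.ofReal (32 * Real.pi ^ 4) := by gcongr
            _ = _ := by ring
        · simp
    _ = _ := by
        simp only [lintegral_const_mul _ (hw.pow_const 2)]
        rw [lintegral_mul_const _ (by fun_prop), lintegral_const_mul _ (hw.pow_const 2)]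
        ring

theorem mul_le_sq_add_sq_ennreal (x y : ℝ≥0∞) : x * y ≤ x ^ 2 + y ^ 2 := by
  rcases le_total x y with h | h
  · calc x * y ≤ y * y := by gcongr
      _ ≤ _ := by rw [← pow_two]; exact le_add_self
  · calc x * y ≤ x * x := by gcongr
      _ ≤ _ := by rw [← pow_two]; exact le_self_add

/-- Cauchy-Schwarz, pointwise, turns the product of four weights into squares over a single pair,
after which the kernel is integrated over the other pair. -/
theorem lintegral_pairedIntegrand_le {ε : ℝ} (hε : 0 < ε) (hw : Measurable w) :
    ∫⁻ a, ∫⁻ b, ∫⁻ c, ∫⁻ d, pairedIntegrand ε w (a, b, c, d) ∂surfaceMeasure ∂surfaceMeasure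
        ∂surfaceMeasure ∂surfaceMeasure
      ≤ 2 * (ENNReal.ofReal (32 * Real.pi ^ 4) * (∫⁻ a, w a ^ 2 ∂surfaceMeasure) ^ 2) := by
  have hS := measurable_pairSquare ε hw
  have hpt : ∀ a b c d : S2, pairedIntegrand ε w (a, b, c, d)
      ≤ pairSquare ε w (a, b, c, d) + pairSquare ε w (c, d, a, b) := by
    intro a b c d
    simp only [pairedIntegrand, pairSquare]
    by_cases h : 1 / 2 ≤ ‖(a + b : R3)‖ ∧ 1 / 2 ≤ ‖(c + d : R3)‖
    · rw [if_pos h, if_pos h.1, if_pos h.2, show (c + d + a + b : R3) = a + b + c + d by abel, ← add_mul]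
      gcongr
      calc w a * w b * w c * w d = (w a * w b) * (w c * w d) := by ring
        _ ≤ _ := mul_le_sq_add_sq_ennreal _ _
        _ = _ := by ring
    · rw [if_neg h]
      exact zero_le
  calc _ ≤ ∫⁻ a, ∫⁻ b, ∫⁻ c, ∫⁻ d, (pairSquare ε w (a, b, c, d) + pairSquare ε w (c, d, a, b))
        ∂surfaceMeasure ∂surfaceMeasure ∂surfaceMeasure ∂surfaceMeasure :=
        lintegral_mono fun a => lintegral_mono fun b => lintegral_mono fun c =>
          lintegral_mono fun d => hpt a b c d
    _ = (∫⁻ a, ∫⁻ b, ∫⁻ c, ∫⁻ d, pairSquare ε w (a, b, c, d) ∂surfaceMeasure ∂surfaceMeasure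
        ∂surfaceMeasure ∂surfaceMeasure) + ∫⁻ a, ∫⁻ b, ∫⁻ c, ∫⁻ d, pairSquare ε w (c, d, a, b)
        ∂surfaceMeasure ∂surfaceMeasure ∂surfaceMeasure ∂surfaceMeasure := by
        rw [← lintegral_four_add (G := fun q => pairSquare ε w (q.2.2.1, q.2.2.2, q.1, q.2.1)) hS]
    _ ≤ _ := by
        rw [lintegral_four_swap_pairs hS, ← two_mul]
        gcongr
        exact lintegral_pairSquare_le hε hw

/-- The quadrilinear form with Gaussian kernel is bounded uniformly in the width. Where the sum of
the four points is large the kernel is bounded; elsewhere one of the three pairings has no nearly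
antipodal pair. -/
theorem lintegral_quadrilinear_le {ε : ℝ} (hε : 0 < ε) (hε1 : ε ≤ 1) (hw : Measurable w) :
    ∫⁻ a, ∫⁻ b, ∫⁻ c, ∫⁻ d, w a * w b * w c * w d *
        ENNReal.ofReal (gaussianKernel ε (a + b + c + d)) ∂surfaceMeasure ∂surfaceMeasure
        ∂surfaceMeasure ∂surfaceMeasure
      ≤ ENNReal.ofReal (512 * Real.pi ^ 2) * (∫⁻ a, w a ∂surfaceMeasure) ^ 4 +
        6 * (ENNReal.ofReal (32 * Real.pi ^ 4) * (∫⁻ a, w a ^ 2 ∂surfaceMeasure) ^ 2) := by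
  have hP := measurable_pairedIntegrand ε hw
  have hpt : ∀ a b c d : S2, w a * w b * w c * w d *
        ENNReal.ofReal (gaussianKernel ε (a + b + c + d))
      ≤ ENNReal.ofReal (512 * Real.pi ^ 2) * w a * w b * w c * w d +
        (pairedIntegrand ε w (a, b, c, d) + (pairedIntegrand ε w (a, c, b, d)
          + pairedIntegrand ε w (b, c, a, d))) := by
    intro a b c d
    by_cases h : ‖(a + b + c + d : R3)‖ ≤ 1 / 2
    · refine le_add_left ?_
      have h1 : (a + c + b + d : R3) = a + b + c + d := by abel
      have h2 : (b + c + a + d : R3) = a + b + c + d := by abel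
      simp only [pairedIntegrand, h1, h2]
      rcases exists_pairing_of_norm_add_le a b c d h with h' | h' | h'
      · rw [if_pos h']
        exact le_self_add
      · rw [if_pos h']
        refine le_add_left (le_add_right (le_of_eq ?_))
        ring
      · rw [if_pos h']
        refine le_add_left (le_add_left (le_of_eq ?_))
        ring
    · refine le_add_right ?_
      calc _ ≤ w a * w b * w c * w d * ENNReal.ofReal (512 * Real.pi ^ 2) := by
            gcongr
            exact gaussianKernel_le_of_half_lt_norm hε hε1 (not_le.1 h)
        _ = _ := by ring
  have hmain := lintegral_pairedIntegrand_le hε hw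
  have h1 : ∫⁻ a, ∫⁻ b, ∫⁻ c, ∫⁻ d, pairedIntegrand ε w (b, c, a, d) ∂surfaceMeasure
      ∂surfaceMeasure ∂surfaceMeasure ∂surfaceMeasure
      = ∫⁻ a, ∫⁻ b, ∫⁻ c, ∫⁻ d, pairedIntegrand ε w (a, b, c, d) ∂surfaceMeasure
      ∂surfaceMeasure ∂surfaceMeasure ∂surfaceMeasure := by
    rw [lintegral_four_swap_left (F := fun q => pairedIntegrand ε w (q.1, q.2.2.1, q.2.1, q.2.2.2))
      (by fun_prop), lintegral_four_swap_middle hP]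
  calc _ ≤ ∫⁻ a, ∫⁻ b, ∫⁻ c, ∫⁻ d, (ENNReal.ofReal (512 * Real.pi ^ 2) * w a * w b * w c * w d +
        (pairedIntegrand ε w (a, b, c, d) + (pairedIntegrand ε w (a, c, b, d)
          + pairedIntegrand ε w (b, c, a, d)))) ∂surfaceMeasure ∂surfaceMeasure ∂surfaceMeasure
          ∂surfaceMeasure :=
        lintegral_mono fun a => lintegral_mono fun b => lintegral_mono fun c =>
          lintegral_mono fun d => hpt a b c d
    _ = (∫⁻ a, ∫⁻ b, ∫⁻ c, ∫⁻ d, ENNReal.ofReal (512 * Real.pi ^ 2) * w a * w b * w c * w d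
          ∂surfaceMeasure ∂surfaceMeasure ∂surfaceMeasure ∂surfaceMeasure) +
        ((∫⁻ a, ∫⁻ b, ∫⁻ c, ∫⁻ d, pairedIntegrand ε w (a, b, c, d) ∂surfaceMeasure
          ∂surfaceMeasure ∂surfaceMeasure ∂surfaceMeasure) +
        ((∫⁻ a, ∫⁻ b, ∫⁻ c, ∫⁻ d, pairedIntegrand ε w (a, c, b, d) ∂surfaceMeasure
          ∂surfaceMeasure ∂surfaceMeasure ∂surfaceMeasure) +
        ∫⁻ a, ∫⁻ b, ∫⁻ c, ∫⁻ d, pairedIntegrand ε w (b, c, a, d) ∂surfaceMeasure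
          ∂surfaceMeasure ∂surfaceMeasure ∂surfaceMeasure)) := by
        rw [lintegral_four_add (F := fun q => ENNReal.ofReal (512 * Real.pi ^ 2) * w q.1 * w q.2.1 *
            w q.2.2.1 * w q.2.2.2) (G := fun q => pairedIntegrand ε w q + (pairedIntegrand ε w
            (q.1, q.2.2.1, q.2.1, q.2.2.2) + pairedIntegrand ε w
            (q.2.1, q.2.2.1, q.1, q.2.2.2))) (by fun_prop),
          lintegral_four_add (G := fun q => pairedIntegrand ε w
            (q.1, q.2.2.1, q.2.1, q.2.2.2) + pairedIntegrand ε w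
            (q.2.1, q.2.2.1, q.1, q.2.2.2)) hP,
          lintegral_four_add (F := fun q => pairedIntegrand ε w (q.1, q.2.2.1, q.2.1, q.2.2.2))
            (G := fun q => pairedIntegrand ε w (q.2.1, q.2.2.1, q.1, q.2.2.2)) (by fun_prop)]
    _ ≤ _ := by
        rw [h1, lintegral_four_swap_middle hP]
        refine add_le_add (le_of_eq ?_) ?_
        · exact lintegral_four_mul _ hw
        · calc _ ≤ _ := add_le_add hmain (add_le_add hmain hmain)
            _ = _ := by ring

end QuadrilinearBound

/-! ### Rearrangement and the energy of the Fourier extension -/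

section ExtensionEnergy

/-- The fourth power of the `L⁴` norm of the Fourier transform of `f σ`. -/
noncomputable def extensionEnergy (f : S2 → ℂ) : ℝ≥0∞ :=
  ∫⁻ ξ, ‖fourierExtension f ξ‖ₑ ^ 4

/-- The sum map, which carries `σ ⊗ σ` to `σ * σ`. -/
def pairSum (p : S2 × S2) : R3 := p.1 + p.2

theorem measurable_pairSum : Measurable pairSum := by
  unfold pairSum
  fun_prop

theorem phaseIntegral_pairSum_mul (f g : S2 → ℂ) (ξ : R3) :
    phaseIntegral (surfaceMeasure.prod surfaceMeasure) pairSum (fun p => f p.1 * g p.2) ξ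
      = fourierExtension f ξ * fourierExtension g ξ := by
  unfold phaseIntegral fourierExtension
  rw [← integral_prod_mul]
  congr 1
  funext p
  simp only [pairSum, inner_add_left, Complex.ofReal_add, mul_add, neg_add, Complex.exp_add]
  ring

theorem extensionEnergy_eq_lintegral_phaseIntegral (f : S2 → ℂ) :
    extensionEnergy f = ∫⁻ ξ, ‖phaseIntegral (surfaceMeasure.prod surfaceMeasure) pairSum
      (fun p => f p.1 * f p.2) ξ‖ₑ ^ 2 := by
  refine lintegral_congr fun ξ => ?_
  rw [phaseIntegral_pairSum_mul, enorm_mul]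
  ring

theorem extensionEnergy_congr_ae {f g : S2 → ℂ} (h : f =ᵐ[surfaceMeasure] g) :
    extensionEnergy f = extensionEnergy g := by
  refine lintegral_congr fun ξ => ?_
  have : fourierExtension f ξ = fourierExtension g ξ := by
    refine integral_congr_ae ?_
    filter_upwards [h] with x hx
    rw [hx]
  rw [this]

theorem extensionEnergy_le_norm {f : S2 → ℂ} (hf : Integrable f surfaceMeasure) :
    extensionEnergy f ≤ extensionEnergy (fun x => (‖f x‖ : ℂ)) := by
  rw [extensionEnergy_eq_lintegral_phaseIntegral, extensionEnergy_eq_lintegral_phaseIntegral]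
  have h := lintegral_phaseIntegral_le measurable_pairSum (hf.mul_prod hf)
    (k := fun p : S2 × S2 => ‖f p.1‖ * ‖f p.2‖) (hf.norm.mul_prod hf.norm)
    fun p => (norm_mul _ _).le
  simpa only [Complex.ofReal_mul] using h

/-- For real `f`, the antipodal map acts on the Fourier transform of `f σ` by conjugation. -/
theorem fourierExtension_comp_neg (f : S2 → ℝ) (ξ : R3) :
    fourierExtension (fun x => ((f (-x) : ℝ) : ℂ)) ξ
      = (starRingEnd ℂ) (fourierExtension (fun x => (f x : ℂ)) ξ) := by
  have hemb : MeasurableEmbedding (fun x : S2 => -x) :=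
    (Homeomorph.neg S2).measurableEmbedding
  have h := measurePreserving_neg_surfaceMeasure.integral_comp hemb (fun x : S2 =>
    Complex.exp (-(Complex.I * ((inner ℝ ((-x : S2) : R3) ξ : ℝ) : ℂ))) * ((f x : ℝ) : ℂ))
  unfold fourierExtension
  simp only [neg_neg] at h
  rw [h, ← integral_conj]
  congr 1
  funext x
  simp [← Complex.exp_conj]

theorem antipodalRearrangement_neg (f : S2 → ℝ) (x : S2) :
    antipodalRearrangement f (-x) = antipodalRearrangement f x :=
  ((isAntipodalRearrangement_iff f _).2 rfl).symm x

theorem antipodalRearrangement_nonneg (f : S2 → ℝ) (x : S2) : 0 ≤ antipodalRearrangement f x :=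
  Real.sqrt_nonneg _

theorem antipodalRearrangement_congr_ae {f g : S2 → ℝ} (h : f =ᵐ[surfaceMeasure] g) :
    antipodalRearrangement f =ᵐ[surfaceMeasure] antipodalRearrangement g := by
  filter_upwards [h, measurePreserving_neg_surfaceMeasure.quasiMeasurePreserving.ae h]
    with x h1 h2
  simp only [antipodalRearrangement, h1, h2]

theorem add_neg_le_two_mul_antipodalRearrangement (f : S2 → ℝ) (x : S2) :
    f x + f (-x) ≤ 2 * antipodalRearrangement f x := by
  have h : (f x + f (-x)) / 2 ≤ antipodalRearrangement f x := by
    refine Real.le_sqrt_of_sq_le ?_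
    nlinarith [sq_nonneg (f x - f (-x))]
  linarith

/-- Cauchy-Schwarz for the vectors `(f a, f (-a))` and `(f (-b), f b)`. -/
theorem symmetrized_mul_le (f : S2 → ℝ) (a b : S2) :
    (f a * f (-b) + f (-a) * f b) / 2
      ≤ antipodalRearrangement f a * antipodalRearrangement f b := by
  rw [antipodalRearrangement, antipodalRearrangement, ← Real.sqrt_mul (by positivity)]
  refine Real.le_sqrt_of_sq_le ?_
  nlinarith [sq_nonneg (f a * f b - f (-a) * f (-b))]

/-- The adjoint restriction inequality, in qualitative form, for nonnegative symmetric functions.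
Symmetry lets the kernel be evaluated at `a + b + c + d` instead of `a + b - c - d`. -/
theorem extensionEnergy_lt_top_of_symmetric {g : S2 → ℝ} (hg : Measurable g)
    (hg2 : MemLp g 2 surfaceMeasure) (hg0 : ∀ x, 0 ≤ g x) (hsymm : ∀ x, g (-x) = g x) :
    extensionEnergy (fun x => (g x : ℂ)) < ⊤ := by
  have hgi : Integrable g surfaceMeasure := hg2.integrable (by norm_num)
  set w : S2 → ℝ≥0∞ := fun x => ENNReal.ofReal (g x) with hw
  have hwm : Measurable w := by fun_prop
  set B : ℝ≥0∞ := ENNReal.ofReal (512 * Real.pi ^ 2) * (∫⁻ a, w a ∂surfaceMeasure) ^ 4 +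
        6 * (ENNReal.ofReal (32 * Real.pi ^ 4) * (∫⁻ a, w a ^ 2 ∂surfaceMeasure) ^ 2) with hB
  have hB_top : B < ⊤ := by
    have h1 : ∫⁻ a, w a ∂surfaceMeasure ≠ ⊤ := hgi.lintegral_lt_top.ne
    have h2 : ∫⁻ a, w a ^ 2 ∂surfaceMeasure ≠ ⊤ := by
      simp only [hw, ← ENNReal.ofReal_pow (hg0 _)]
      exact hg2.integrable_sq.lintegral_lt_top.ne
    refine ENNReal.add_lt_top.2 ⟨ENNReal.mul_lt_top ENNReal.ofReal_lt_top
      (ENNReal.pow_lt_top h1.lt_top), ENNReal.mul_lt_top (by norm_num)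
      (ENNReal.mul_lt_top ENNReal.ofReal_lt_top (ENNReal.pow_lt_top h2.lt_top))⟩
  refine lt_of_le_of_lt ?_ hB_top
  have hk : Integrable (fun p : S2 × S2 => g p.1 * g p.2) (surfaceMeasure.prod surfaceMeasure) :=
    hgi.mul_prod hgi
  have hG : ∀ ε, Measurable (gaussianKernel ε) := fun ε => (continuous_gaussianKernel ε).measurable
  have hbound : ∀ ε : ℝ, 0 < ε → ε ≤ 1 → ENNReal.ofReal (gaussianEnergy ε (phaseIntegral
      (surfaceMeasure.prod surfaceMeasure) pairSum (fun p => ((g p.1 * g p.2 : ℝ) : ℂ)))) ≤ B := by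
    intro ε hε hε1
    refine le_trans (le_of_eq ?_) (lintegral_quadrilinear_le hε hε1 hwm)
    rw [gaussianEnergy_phaseIntegral_ofReal measurable_pairSum hε hk,
      ofReal_integral_eq_lintegral_ofReal
        (integrable_mul_gaussianKernel measurable_pairSum hε hk hk) (ae_of_all _ fun p => by
          have := (gaussianKernel_pos hε (pairSum p.1 - pairSum p.2)).le
          have := hg0 p.1.1
          have := hg0 p.1.2
          have := hg0 p.2.1
          have := hg0 p.2.2
          simp only [Pi.zero_apply]
          positivity)]
    have hpm := measurable_pairSum
    have hGε := hG ε
    rw [lintegral_prod _ (by fun_prop), lintegral_prod _ (by fun_prop)]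
    refine lintegral_congr fun a => lintegral_congr fun b => ?_
    rw [lintegral_prod _ (by fun_prop)]
    have hval : ∀ c d : S2, ENNReal.ofReal (g a * g b * (g c * g d) *
        gaussianKernel ε (pairSum (a, b) - pairSum (c, d)))
        = w a * w b * w (-c) * w (-d) *
          ENNReal.ofReal (gaussianKernel ε (a + b + ((-c : S2) : R3) + ((-d : S2) : R3))) := by
      intro c d
      simp only [hw, hsymm]
      have hz : pairSum (a, b) - pairSum (c, d)
          = (a + b + ((-c : S2) : R3) + ((-d : S2) : R3) : R3) := by
        simp only [pairSum, Metric.sphere, coe_neg_sphere]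
        abel
      rw [hz, ← ENNReal.ofReal_mul (hg0 _), ← ENNReal.ofReal_mul (mul_nonneg (hg0 _) (hg0 _)),
        ← ENNReal.ofReal_mul (mul_nonneg (mul_nonneg (hg0 _) (hg0 _)) (hg0 _)),
        ← ENNReal.ofReal_mul (mul_nonneg (mul_nonneg (mul_nonneg (hg0 _) (hg0 _)) (hg0 _))
          (hg0 _))]
      congr 1
      ring
    simp only [hval]
    have hd : ∀ c : S2, ∫⁻ d : S2, w a * w b * w (-c) * w (-d) *
          ENNReal.ofReal (gaussianKernel ε (a + b + ((-c : S2) : R3) + ((-d : S2) : R3)))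
            ∂surfaceMeasure
        = ∫⁻ d : S2, w a * w b * w (-c) * w d *
          ENNReal.ofReal (gaussianKernel ε (a + b + ((-c : S2) : R3) + d)) ∂surfaceMeasure :=
      fun c => measurePreserving_neg_surfaceMeasure.lintegral_comp (f := fun d : S2 =>
        w a * w b * w (-c) * w d *
          ENNReal.ofReal (gaussianKernel ε (a + b + ((-c : S2) : R3) + d))) (by fun_prop)
    simp only [hd]
    exact measurePreserving_neg_surfaceMeasure.lintegral_comp (f := fun c : S2 =>
        ∫⁻ d : S2, w a * w b * w c * w d *
          ENNReal.ofReal (gaussianKernel ε (a + b + c + d)) ∂surfaceMeasure) (by fun_prop)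
  rw [extensionEnergy_eq_lintegral_phaseIntegral]
  simp only [← Complex.ofReal_mul]
  refine le_of_tendsto' (tendsto_gaussianEnergy
    (continuous_phaseIntegral measurable_pairSum hk.ofReal) (norm_phaseIntegral_le _)) fun n => ?_
  refine hbound _ (by positivity) ?_
  rw [div_le_one (by positivity)]
  have : (0 : ℝ) ≤ n := n.cast_nonneg
  linarith

theorem extensionEnergy_antipodalRearrangement_lt_top {f : S2 → ℝ}
    (hf : MemLp f 2 surfaceMeasure) :
    extensionEnergy (fun x => (antipodalRearrangement f x : ℂ)) < ⊤ := by
  have hfm := hf.aestronglyMeasurable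
  set f' : S2 → ℝ := hfm.mk f
  have hff' : f =ᵐ[surfaceMeasure] f' := hfm.ae_eq_mk
  have hf'm : Measurable f' := hfm.measurable_mk
  have hc : extensionEnergy (fun x => (antipodalRearrangement f x : ℂ))
      = extensionEnergy (fun x => (antipodalRearrangement f' x : ℂ)) := by
    refine extensionEnergy_congr_ae ?_
    filter_upwards [antipodalRearrangement_congr_ae hff'] with x hx
    rw [hx]
  rw [hc]
  refine extensionEnergy_lt_top_of_symmetric ?_
    (memLp_antipodalRearrangement ((memLp_congr_ae hff').1 hf))
    (antipodalRearrangement_nonneg f') (antipodalRearrangement_neg f')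
  have hneg : Measurable (fun x : S2 => -x) := measurePreserving_neg_surfaceMeasure.measurable
  unfold antipodalRearrangement
  fun_prop

/-- The excess of the rearranged product over the symmetrized product. -/
noncomputable def rearrangementDefect (f : S2 → ℝ) (p : S2 × S2) : ℝ :=
  antipodalRearrangement f p.1 * antipodalRearrangement f p.2
    - (f p.1 * f (-p.2) + f (-p.1) * f p.2) / 2

theorem integrable_comp_neg {f : S2 → ℝ} (hf : Integrable f surfaceMeasure) :
    Integrable (fun x => f (-x)) surfaceMeasure :=
  measurePreserving_neg_surfaceMeasure.integrable_comp_of_integrable hf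

theorem integrable_symmetrized_mul {f : S2 → ℝ} (hf : Integrable f surfaceMeasure) :
    Integrable (fun p : S2 × S2 => (f p.1 * f (-p.2) + f (-p.1) * f p.2) / 2)
      (surfaceMeasure.prod surfaceMeasure) :=
  ((hf.mul_prod (integrable_comp_neg hf)).add ((integrable_comp_neg hf).mul_prod hf)).div_const 2

/-- The density of `fσ * f̃σ` on pairs, where `f̃ = f ∘ (-·)`, may be symmetrized without changing
its image under the sum map. -/
theorem phaseIntegral_symmetrized_mul {f : S2 → ℝ} (hf : Integrable f surfaceMeasure) (ξ : R3) :
    phaseIntegral (surfaceMeasure.prod surfaceMeasure) pairSum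
        (fun p => (((f p.1 * f (-p.2) + f (-p.1) * f p.2) / 2 : ℝ) : ℂ)) ξ
      = fourierExtension (fun x => (f x : ℂ)) ξ *
          fourierExtension (fun x => ((f (-x) : ℝ) : ℂ)) ξ := by
  have hfn := integrable_comp_neg hf
  have h1 := phaseIntegral_pairSum_mul (fun x => (f x : ℂ)) (fun x => ((f (-x) : ℝ) : ℂ)) ξ
  have h2 := phaseIntegral_pairSum_mul (fun x => ((f (-x) : ℝ) : ℂ)) (fun x => (f x : ℂ)) ξ
  have hphase : ∀ {k : S2 × S2 → ℂ}, Integrable k (surfaceMeasure.prod surfaceMeasure) →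
      Integrable (fun p => Complex.exp (-(Complex.I * ((inner ℝ (pairSum p) ξ : ℝ) : ℂ))) * k p)
        (surfaceMeasure.prod surfaceMeasure) := by
    intro k hk
    have := measurable_pairSum
    refine hk.bdd_mul (c := 1) (Measurable.aestronglyMeasurable (by fun_prop))
      (ae_of_all _ fun p => ?_)
    rw [norm_exp_neg_I_mul]
  have h3 : phaseIntegral (surfaceMeasure.prod surfaceMeasure) pairSum
        (fun p => (((f p.1 * f (-p.2) + f (-p.1) * f p.2) / 2 : ℝ) : ℂ)) ξ
      = (phaseIntegral (surfaceMeasure.prod surfaceMeasure) pairSum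
          (fun p => (f p.1 : ℂ) * ((f (-p.2) : ℝ) : ℂ)) ξ +
        phaseIntegral (surfaceMeasure.prod surfaceMeasure) pairSum
          (fun p => ((f (-p.1) : ℝ) : ℂ) * (f p.2 : ℂ)) ξ) / 2 := by
    simp only [phaseIntegral]
    have hi1 : Integrable (fun p : S2 × S2 => (f p.1 : ℂ) * ((f (-p.2) : ℝ) : ℂ))
        (surfaceMeasure.prod surfaceMeasure) := hf.ofReal.mul_prod hfn.ofReal
    have hi2 : Integrable (fun p : S2 × S2 => ((f (-p.1) : ℝ) : ℂ) * (f p.2 : ℂ))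
        (surfaceMeasure.prod surfaceMeasure) := hfn.ofReal.mul_prod hf.ofReal
    rw [← integral_add (hphase hi1) (hphase hi2), ← integral_div]
    congr 1
    funext p
    push_cast
    ring
  rw [h3, h1, h2]
  ring

/-- The energy gained by rearrangement dominates the energy of the defect. -/
theorem extensionEnergy_add_defect_le {f : S2 → ℝ} (hf : MemLp f 2 surfaceMeasure)
    (hf0 : ∀ x, 0 ≤ f x) :
    extensionEnergy (fun x => (f x : ℂ)) +
        (∫⁻ ξ, ‖phaseIntegral (surfaceMeasure.prod surfaceMeasure) pairSum
          (fun p => (rearrangementDefect f p : ℂ)) ξ‖ₑ ^ 2)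
      ≤ extensionEnergy (fun x => (antipodalRearrangement f x : ℂ)) := by
  have hfi : Integrable f surfaceMeasure := hf.integrable (by norm_num)
  have hri : Integrable (antipodalRearrangement f) surfaceMeasure :=
    (memLp_antipodalRearrangement hf).integrable (by norm_num)
  have h := lintegral_phaseIntegral_add_le measurable_pairSum (integrable_symmetrized_mul hfi)
    (l := rearrangementDefect f) ((hri.mul_prod hri).sub (integrable_symmetrized_mul hfi))
    (fun p => by
      have h1 := mul_nonneg (hf0 p.1) (hf0 (-p.2))
      have h2 := mul_nonneg (hf0 (-p.1)) (hf0 p.2)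
      positivity)
    (fun p => sub_nonneg.2 (symmetrized_mul_le f p.1 p.2))
  rw [extensionEnergy_eq_lintegral_phaseIntegral (fun x => (antipodalRearrangement f x : ℂ))]
  refine le_trans (le_of_eq ?_) (h.trans (le_of_eq ?_))
  · congr 1
    refine lintegral_congr fun ξ => ?_
    rw [phaseIntegral_symmetrized_mul hfi, fourierExtension_comp_neg, enorm_mul, RCLike.enorm_conj]
    ring
  · refine lintegral_congr fun ξ => ?_
    congr 4
    funext p
    rw [← Complex.ofReal_mul]
    congr 1
    simp only [rearrangementDefect]
    ring

/-- If the defect has zero mass then `∫ f = ∫ f⋆`; since `f x + f (-x) ≤ 2 f⋆ x`, with equality only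
when `f x = f (-x)`, the function `f` is symmetric. -/
theorem ae_eq_antipodalRearrangement_of_integral_defect_eq_zero {f : S2 → ℝ}
    (hf : MemLp f 2 surfaceMeasure) (hf0 : ∀ x, 0 ≤ f x)
    (h0 : ∫ p, rearrangementDefect f p ∂(surfaceMeasure.prod surfaceMeasure) = 0) :
    f =ᵐ[surfaceMeasure] antipodalRearrangement f := by
  have hfi : Integrable f surfaceMeasure := hf.integrable (by norm_num)
  have hfn := integrable_comp_neg hfi
  have hri : Integrable (antipodalRearrangement f) surfaceMeasure :=
    (memLp_antipodalRearrangement hf).integrable (by norm_num)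
  have hneg : ∫ x, f (-x) ∂surfaceMeasure = ∫ x, f x ∂surfaceMeasure :=
    measurePreserving_neg_surfaceMeasure.integral_comp
      (Homeomorph.neg S2).measurableEmbedding f
  unfold rearrangementDefect at h0
  rw [integral_sub (hri.mul_prod hri) (integrable_symmetrized_mul hfi), integral_div,
    integral_add (hfi.mul_prod hfn) (hfn.mul_prod hfi), integral_prod_mul,
    integral_prod_mul f (fun x => f (-x)), integral_prod_mul (fun x => f (-x)) f, hneg] at h0
  have h1 : 0 ≤ ∫ x, f x ∂surfaceMeasure := integral_nonneg hf0
  have h2 : 0 ≤ ∫ x, antipodalRearrangement f x ∂surfaceMeasure :=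
    integral_nonneg (antipodalRearrangement_nonneg f)
  have h3 : ∫ x, antipodalRearrangement f x ∂surfaceMeasure = ∫ x, f x ∂surfaceMeasure := by
    nlinarith
  have h4 : ∫ x, (2 * antipodalRearrangement f x - (f x + f (-x))) ∂surfaceMeasure = 0 := by
    rw [integral_sub (g := fun x => f x + f (-x)) (hri.const_mul 2) (hfi.add hfn),
      integral_const_mul, integral_add hfi hfn,
      hneg, h3]
    ring
  rw [integral_eq_zero_iff_of_nonneg
    (fun x => sub_nonneg.2 (add_neg_le_two_mul_antipodalRearrangement f x))
    ((hri.const_mul 2).sub (hfi.add hfn))] at h4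
  filter_upwards [h4] with x hx
  have hx' : 2 * antipodalRearrangement f x = f x + f (-x) := sub_eq_zero.1 hx
  have hsq : antipodalRearrangement f x ^ 2 = (f x ^ 2 + f (-x) ^ 2) / 2 :=
    Real.sq_sqrt (by positivity)
  have h5 : (f x - f (-x)) ^ 2 = 0 := by
    linear_combination -4 * hsq + (2 * antipodalRearrangement f x + (f x + f (-x))) * hx'
  have h6 : f x = f (-x) := sub_eq_zero.1 (pow_eq_zero_iff (by norm_num) |>.1 h5)
  linarith

theorem antipodalRearrangement_abs (f : S2 → ℝ) :
    antipodalRearrangement (fun x => |f x|) = antipodalRearrangement f := by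
  funext x
  simp only [antipodalRearrangement, sq_abs]

theorem extensionEnergy_le_antipodalRearrangement {f : S2 → ℝ} (hf : MemLp f 2 surfaceMeasure)
    (hf0 : ∀ᵐ x ∂surfaceMeasure, 0 ≤ f x) :
    extensionEnergy (fun x => (f x : ℂ))
      ≤ extensionEnergy (fun x => (antipodalRearrangement f x : ℂ)) := by
  have h := extensionEnergy_add_defect_le hf.abs (fun x => abs_nonneg (f x))
  have hae : (fun x => (f x : ℂ)) =ᵐ[surfaceMeasure] fun x => ((|f x| : ℝ) : ℂ) := by
    filter_upwards [hf0] with x hx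
    rw [abs_of_nonneg hx]
  rw [extensionEnergy_congr_ae hae, ← antipodalRearrangement_abs]
  exact le_self_add.trans h

theorem extensionEnergy_lt_antipodalRearrangement {f : S2 → ℝ} (hf : MemLp f 2 surfaceMeasure)
    (hf0 : ∀ᵐ x ∂surfaceMeasure, 0 ≤ f x)
    (hne : ¬ f =ᵐ[surfaceMeasure] antipodalRearrangement f) :
    extensionEnergy (fun x => (f x : ℂ))
      < extensionEnergy (fun x => (antipodalRearrangement f x : ℂ)) := by
  refine (extensionEnergy_le_antipodalRearrangement hf hf0).lt_of_ne fun heq => hne ?_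
  have hf' : MemLp (fun x => |f x|) 2 surfaceMeasure := hf.abs
  have haef : f =ᵐ[surfaceMeasure] fun x => |f x| := by
    filter_upwards [hf0] with x hx
    rw [abs_of_nonneg hx]
  have hae : (fun x => (f x : ℂ)) =ᵐ[surfaceMeasure] fun x => ((|f x| : ℝ) : ℂ) := by
    filter_upwards [haef] with x hx
    rw [← hx]
  have h := extensionEnergy_add_defect_le hf' (fun x => abs_nonneg (f x))
  have htop := extensionEnergy_antipodalRearrangement_lt_top hf
  rw [← extensionEnergy_congr_ae hae, antipodalRearrangement_abs, ← heq] at h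
  rw [← heq] at htop
  have hzero : (∫⁻ ξ, ‖phaseIntegral (surfaceMeasure.prod surfaceMeasure) pairSum
          (fun p => (rearrangementDefect (fun x => |f x|) p : ℂ)) ξ‖ₑ ^ 2) = 0 := by
    have h' := h.trans (add_zero _).symm.le
    exact le_antisymm ((ENNReal.add_le_add_iff_left htop.ne).1 h') zero_le
  have hri := (memLp_antipodalRearrangement hf').integrable (q := 2) (by norm_num)
  have hint : Integrable (rearrangementDefect (fun x => |f x|))
      (surfaceMeasure.prod surfaceMeasure) :=
    (hri.mul_prod hri).sub (integrable_symmetrized_mul (hf'.integrable (by norm_num)))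
  have h1 := integral_eq_zero_of_lintegral_phaseIntegral_eq_zero measurable_pairSum hint hzero
  have h2 := ae_eq_antipodalRearrangement_of_integral_defect_eq_zero hf'
    (fun x => abs_nonneg (f x)) h1
  have h3 := haef.trans h2
  rwa [antipodalRearrangement_abs] at h3

end ExtensionEnergy

/-! ### The norm of the self-convolution -/

section ConvolutionNorm

theorem charFun_densityMeasure {f : S2 → ℝ} (hf : Integrable f surfaceMeasure)
    (hf0 : ∀ᵐ x ∂surfaceMeasure, 0 ≤ f x) (ξ : R3) :
    charFun (densityMeasure f) ξ = fourierExtension (fun x => (f x : ℂ)) (-ξ) := by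
  rw [charFun_apply, densityMeasure, integral_map (by fun_prop)
    (Measurable.aestronglyMeasurable (by fun_prop)),
    integral_withDensity_eq_integral_toReal_smul₀ hf.aemeasurable.ennreal_ofReal (by simp)]
  refine integral_congr_ae ?_
  filter_upwards [hf0] with x hx
  rw [ENNReal.toReal_ofReal hx, Complex.real_smul, inner_neg_right, mul_comm]
  congr 2
  push_cast
  ring

/-- The constant by which `L²` norms change under the frequency scaling `ξ ↦ -2πξ`. -/
noncomputable def plancherelConstant : ℝ≥0∞ :=
  ENNReal.ofReal |((-(2 * Real.pi)) ^ Module.finrank ℝ R3)⁻¹| ^ (1 / 2 : ℝ)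

theorem plancherelConstant_ne_zero : plancherelConstant ≠ 0 := by
  have : 0 < |((-(2 * Real.pi)) ^ Module.finrank ℝ R3)⁻¹| := by
    rw [abs_pos]
    exact inv_ne_zero (pow_ne_zero _ (by simp [Real.pi_ne_zero]))
  exact (ENNReal.rpow_pos (ENNReal.ofReal_pos.2 this) ENNReal.ofReal_ne_top).ne'

theorem plancherelConstant_ne_top : plancherelConstant ≠ ⊤ :=
  ENNReal.rpow_ne_top_of_nonneg (by norm_num) ENNReal.ofReal_ne_top

theorem selfConvL2Norm_eq {f : S2 → ℝ} (hf : Integrable f surfaceMeasure)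
    (hf0 : ∀ᵐ x ∂surfaceMeasure, 0 ≤ f x)
    (hfin : extensionEnergy (fun x => (f x : ℂ)) < ⊤) :
    selfConvL2Norm f
      = plancherelConstant * extensionEnergy (fun x => (f x : ℂ)) ^ (1 / 2 : ℝ) := by
  have : IsFiniteMeasure (surfaceMeasure.withDensity (fun x => ENNReal.ofReal (f x))) :=
    isFiniteMeasure_withDensity_ofReal hf.2
  have hfm : IsFiniteMeasure (densityMeasure f) := by
    unfold densityMeasure
    infer_instance
  set ν := (densityMeasure f).conv (densityMeasure f) with hν
  have hchar : ∫⁻ ξ, ‖charFun ν ξ‖ₑ ^ (2 : ℝ) = extensionEnergy (fun x => (f x : ℂ)) := by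
    rw [extensionEnergy, ← lintegral_neg_eq_self]
    refine lintegral_congr fun ξ => ?_
    rw [hν, charFun_conv, charFun_densityMeasure hf hf0, enorm_mul, ENNReal.rpow_two, ← pow_two,
      ← pow_mul, neg_neg]
  have hnorm : eLpNorm (charFun ν) 2 volume
      = extensionEnergy (fun x => (f x : ℂ)) ^ (1 / 2 : ℝ) := by
    rw [eLpNorm_eq_lintegral_rpow_enorm_toReal (by norm_num) (by norm_num),
      ENNReal.toReal_ofNat, hchar]
  have hmem : MemLp (charFun ν) 2 volume := by
    refine ⟨measurable_charFun.aestronglyMeasurable, ?_⟩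
    rw [hnorm]
    exact ENNReal.rpow_lt_top_of_nonneg (by norm_num) hfin.ne
  obtain ⟨hac, hL2⟩ := eLpNorm_rnDeriv_eq_of_memLp_charFun ν hmem
  rw [selfConvL2Norm, ← hν, measureL2Norm, if_pos hac, hL2,
    eLpNorm_comp_smul (charFun ν) (by simp [Real.pi_ne_zero]), hnorm, plancherelConstant]

theorem selfConvL2Norm_rearrangement {f : S2 → ℝ} (hf : MemLp f 2 surfaceMeasure)
    (hf0 : ∀ᵐ x ∂surfaceMeasure, 0 ≤ f x) :
    selfConvL2Norm f ≤ selfConvL2Norm (antipodalRearrangement f) ∧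
      (¬ f =ᵐ[surfaceMeasure] antipodalRearrangement f →
        selfConvL2Norm f < selfConvL2Norm (antipodalRearrangement f)) := by
  have htop := extensionEnergy_antipodalRearrangement_lt_top hf
  have hle := extensionEnergy_le_antipodalRearrangement hf hf0
  rw [selfConvL2Norm_eq (hf.integrable (by norm_num)) hf0 (hle.trans_lt htop),
    selfConvL2Norm_eq ((memLp_antipodalRearrangement hf).integrable (by norm_num))
      (ae_of_all _ (antipodalRearrangement_nonneg f)) htop]
  refine ⟨by gcongr, fun hne => ?_⟩
  have hlt := extensionEnergy_lt_antipodalRearrangement hf hf0 hne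
  exact (ENNReal.mul_lt_mul_iff_right plancherelConstant_ne_zero plancherelConstant_ne_top).2
    (ENNReal.rpow_lt_rpow hlt (by norm_num))

end ConvolutionNorm

/-! ### Extremizers -/

section Extremizers

theorem eLpNorm_fourierExtension (f : S2 → ℂ) :
    eLpNorm (fourierExtension f) 4 volume = extensionEnergy f ^ (1 / 4 : ℝ) := by
  rw [eLpNorm_eq_lintegral_rpow_enorm_toReal (by norm_num) (by norm_num), ENNReal.toReal_ofNat,
    extensionEnergy]
  congr 1
  refine lintegral_congr fun ξ => ?_
  rw [← ENNReal.rpow_natCast]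
  norm_num

theorem eLpNorm_antipodalRearrangement {f : S2 → ℝ} (hf : MemLp f 2 surfaceMeasure) :
    eLpNorm (antipodalRearrangement f) 2 surfaceMeasure = eLpNorm f 2 surfaceMeasure := by
  have hm := memLp_antipodalRearrangement hf
  have hneg : ∫ x, f (-x) ^ 2 ∂surfaceMeasure = ∫ x, f x ^ 2 ∂surfaceMeasure :=
    measurePreserving_neg_surfaceMeasure.integral_comp
      (Homeomorph.neg S2).measurableEmbedding (fun x => f x ^ 2)
  have hint : ∫ x, antipodalRearrangement f x ^ 2 ∂surfaceMeasure
      = ∫ x, f x ^ 2 ∂surfaceMeasure := by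
    have h1 : ∀ x, antipodalRearrangement f x ^ 2 = (f x ^ 2 + f (-x) ^ 2) / 2 := fun x =>
      Real.sq_sqrt (by positivity)
    simp only [h1]
    rw [integral_div, integral_add hf.integrable_sq (integrable_comp_neg hf.integrable_sq), hneg]
    ring
  rw [hm.eLpNorm_eq_integral_rpow_norm (by norm_num) (by norm_num),
    hf.eLpNorm_eq_integral_rpow_norm (by norm_num) (by norm_num)]
  simp only [ENNReal.toReal_ofNat, Real.rpow_two, Real.norm_eq_abs, sq_abs, hint]

theorem IsExtremizer.norm_neg_ae_eq {f : S2 → ℂ} (hf : IsExtremizer f) :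
    ∀ᵐ x ∂surfaceMeasure, ‖f (-x)‖ = ‖f x‖ := by
  by_contra hcon
  set u : S2 → ℝ := fun x => ‖f x‖ with hu
  have hu2 : MemLp u 2 surfaceMeasure := hf.memLp.norm
  have hne : ¬ u =ᵐ[surfaceMeasure] antipodalRearrangement u := by
    intro h
    refine hcon ?_
    filter_upwards [h, measurePreserving_neg_surfaceMeasure.quasiMeasurePreserving.ae h]
      with x h1 h2
    rw [antipodalRearrangement_neg, ← h1] at h2
    exact h2
  have hlt := extensionEnergy_lt_antipodalRearrangement hu2 (ae_of_all _ fun x => norm_nonneg _) hne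
  have hle := extensionEnergy_le_norm (hf.memLp.integrable (by norm_num))
  set g : S2 → ℂ := fun x => (antipodalRearrangement u x : ℂ) with hg
  have hg2 : MemLp g 2 surfaceMeasure := (memLp_antipodalRearrangement hu2).ofReal
  have hgn : eLpNorm g 2 surfaceMeasure = eLpNorm f 2 surfaceMeasure := by
    have h1 : eLpNorm g 2 surfaceMeasure
        = eLpNorm (antipodalRearrangement u) 2 surfaceMeasure :=
      eLpNorm_congr_norm_ae (ae_of_all _ fun x => Complex.norm_real _)
    rw [h1, eLpNorm_antipodalRearrangement hu2, hu, eLpNorm_norm]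
  have hf0 : eLpNorm f 2 surfaceMeasure ≠ 0 := fun h =>
    hf.ne_zero ((eLpNorm_eq_zero_iff hf.memLp.aestronglyMeasurable (by norm_num)).1 h)
  have hg0 : ¬ g =ᵐ[surfaceMeasure] 0 := fun h =>
    hf0 (by rw [← hgn, eLpNorm_congr_ae h, eLpNorm_zero])
  have hsup : eLpNorm (fourierExtension g) 4 volume / eLpNorm g 2 surfaceMeasure
      ≤ optimalConstant :=
    le_iSup_of_le g (le_iSup_of_le hg2 (le_iSup_of_le hg0 le_rfl))
  rw [hgn, ENNReal.div_le_iff hf0 hf.memLp.eLpNorm_ne_top, ← hf.attains,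
    eLpNorm_fourierExtension, eLpNorm_fourierExtension] at hsup
  exact absurd (ENNReal.rpow_lt_rpow (hle.trans_lt hlt) (by norm_num : (0 : ℝ) < 1 / 4))
    (not_lt.2 hsup)

end Extremizers

end SphereRestriction

theorem proposition2p5 :
    (∀ f : SphereRestriction.S2 → ℝ,
      MemLp f 2 SphereRestriction.surfaceMeasure →
      (∀ᵐ x ∂SphereRestriction.surfaceMeasure, 0 ≤ f x) →
        SphereRestriction.selfConvL2Norm f
            ≤ SphereRestriction.selfConvL2Norm (SphereRestriction.antipodalRearrangement f) ∧
        (¬ f =ᵐ[SphereRestriction.surfaceMeasure] SphereRestriction.antipodalRearrangement f →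
          SphereRestriction.selfConvL2Norm f
            < SphereRestriction.selfConvL2Norm (SphereRestriction.antipodalRearrangement f))) ∧
    (∀ f : SphereRestriction.S2 → ℂ, SphereRestriction.IsExtremizer f →
      ∀ᵐ x ∂SphereRestriction.surfaceMeasure, ‖f (-x)‖ = ‖f x‖) :=
  ⟨fun _ hf hf0 => SphereRestriction.selfConvL2Norm_rearrangement hf hf0,
    fun _ hf => hf.norm_neg_ae_eq⟩
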